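/- **The language.** Programs are given by the grammar $$M,N,L,R ::= a \mid \lambda a.M \mid M\,N \mid M{\downarrow}N \mid \mathbf{rec}\,M \mid \bot \mid \mathbf{Nil} \mid \mathbf{Left}(M) \mid \mathbf{Right}(M) \mid \mathbf{Pair}(M,N) \mid \mathbf{Amb}(M,N) \mid \mathbf{case}\,M\{\mathbf{Left}(a)\to L;\mathbf{Right}(b)\to R\} \mid \mathbf{case}\,M\{\mathbf{Pair}(a,b)\to N\} \mid \mathbf{case}\,M\{\mathbf{Amb}(a,b)\to N\}$$ up to renaming of bound variables. $\mathbf{Nil},\mathbf{Left},\mathbf{Right},\mathbf{Pair},\mathbf{Amb}$ are the constructors, all but $\mathbf{Amb}$ are data constructors. Below, $C$ ranges over constructors and $M[N/a]$ is capture-avoiding substitution. **Denotations.** Let $D$ be the Scott domain that is the canonical (inverse limit) solution of $$D = (\mathbf{Nil} + \mathbf{Left}(D) + \mathbf{Right}(D) + \mathbf{Pair}(D\times D) + \mathbf{Amb}(D\times D) + \mathbf{Fun}(D\to D))_\bot,$$ with separated sums and continuous function space. For an environment $\eta$ put: $[\![a]\!]\eta=\eta(a)$; $[\![\lambda a.M]\!]\eta=\mathbf{Fun}(d\mapsto[\![M]\!]\eta[a\mapsto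 d])$; $[\![M\,N]\!]\eta=f([\![N]\!]\eta)$ if $[\![M]\!]\eta=\mathbf{Fun}(f)$; $[\![M{\downarrow}N]\!]\eta=f([\![N]\!]\eta)$ if $[\![M]\!]\eta=\mathbf{Fun}(f)$ and $[\![N]\!]\eta\neq\bot$; $[\![\mathbf{rec}\,M]\!]\eta$ is the least fixed point of $f$ if $[\![M]\!]\eta=\mathbf{Fun}(f)$; $[\![C(\vec M)]\!]\eta=C(\overrightarrow{[\![M]\!]\eta})$ for every constructor $C$ (including $\mathbf{Amb}$); a case expression on $M$ denotes $[\![K]\!]\eta[\vec a\mapsto\vec d\,]$ if $[\![M]\!]\eta=C(\vec d\,)$ and $C(\vec a)\to K$ is one of its clauses; and the denotation is $\bot$ in all other cases. For closed $M$ write $[\![M]\!]$. For $a\in D$ the set $\mathrm{data}(a)\subseteq D$ is defined coinductively: it is the largest relation such that $d\in\mathrm{data}(a)$ holds iff one of the following holds: $a=\mathbf{Amb}(a',b')$, $a'\ne\bot$, $d\in\mathrm{data}(a')$; or $a=\mathbf{Amb}(a',b')$, $b'\neq\bot$, $d\in\mathrm{data}(b')$; or $a=\mathbf{Amb}(\bot,\bot)$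 and $d=\bot$; or $a=C(\vec{a'})$, $d=C(\vec{d'})$ for a data constructor $C$ and $d_i'\in\mathrm{data}(a_i')$ for all $i$; or $a=\mathbf{Fun}(f)$ and $d=a$; or $a=d=\bot$. **Reductions** (of closed programs). A w.h.n.f. is a program of the form $C(\vec M)$ or $\lambda a.M$. A program is $\bot$-like if it is $\bot$, $C(\vec M)\,N$, $C(\vec M){\downarrow}N$, or a case expression on a w.h.n.f. that matches none of its clauses. The relation $\rightsquigarrow$ is inductively defined by: $(\lambda a.M)N\rightsquigarrow M[N/a]$; $M\,N\rightsquigarrow M'\,N$ if $M\rightsquigarrow M'$; $(\lambda a.M){\downarrow}N\rightsquigarrow M[N/a]$ if $N$ is a w.h.n.f.; $M{\downarrow}N\rightsquigarrow M'{\downarrow}N$ if $M\rightsquigarrow M'$ and $N$ is a w.h.n.f.; $M{\downarrow}N\rightsquigarrow M{\downarrow}N'$ if $N\rightsquigarrow N'$; $\mathbf{rec}\,M\rightsquigarrow M(\mathbf{rec}\,M)$; $\mathbf{case}\,C(\vec M)\{\ldots C(\vec b)\to N\ldots\}\rightsquigarrow N[\vec M/\vec b\,]$; $\mathbf{case}\,M\{\ldots\}\rightsquigarrow\mathbf{case}\,M'\{\ldots\}$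 if $M\rightsquigarrow M'$; $M\rightsquigarrow\bot$ if $M$ is $\bot$-like. The relation $\to_c$ is given by: $M\to_c M'$ if $M\rightsquigarrow M'$; $\mathbf{Amb}(M_1,M_2)\to_c\mathbf{Amb}(M_1',M_2)$ if $M_1\rightsquigarrow M_1'$; $\mathbf{Amb}(M_1,M_2)\to_c\mathbf{Amb}(M_1,M_2')$ if $M_2\rightsquigarrow M_2'$; $\mathbf{Amb}(M_1,M_2)\to_c M_i$ if $M_i$ is a w.h.n.f. ($i=1,2$). The relation $\to_p$ is inductively defined by: $M\to_pM'$ if $M\to_cM'$; $C(M_1,\ldots,M_k)\to_pC(M_1',\ldots,M_k')$ if $C$ is a $k$-ary data constructor and $M_i\to_pM_i'$ for all $i$ (so $\mathbf{Nil}\to_p\mathbf{Nil}$); $\lambda a.M\to_p\lambda a.M$. An infinite sequence $M_0\to_pM_1\to_p\cdots$ being *unfair* is defined inductively: it is unfair if $M_i=\mathbf{Amb}(L_i,R)$ with $L_i\rightsquigarrow L_{i+1}$ for all $i$ ($R$ fixed); or $M_i=\mathbf{Amb}(L,R_i)$ with $R_i\rightsquigarrow R_{i+1}$ for all $i$ ($L$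 fixed); or $M_i=C(N_{i,1},\ldots,N_{i,n})$ for all $i$ with a fixed data constructor $C$ and, for some $k$, $N_{0,k}\to_pN_{1,k}\to_p\cdots$ is unfair; or its tail $M_1\to_pM_2\to_p\cdots$ is unfair. A *computation* of a closed program $M$ is an infinite sequence $M=M_0\to_pM_1\to_p\cdots$ that is not unfair. For a closed program $M$ define $M_D\in D$ by $C(M_1,\ldots,M_k)_D=C((M_1)_D,\ldots,(M_k)_D)$ for data constructors $C$, $(\lambda a.M)_D=[\![\lambda a.M]\!]$, and $M_D=\bot$ otherwise. **Theorem (Computational Adequacy: Soundness).** For every closed program $M$ and every computation $M=M_0\to_pM_1\to_p\cdots$ of $M$, the sequence $((M_i)_D)_{i\in\mathbb N}$ is increasing, so that it has a least upper bound in $D$, and $$\bigsqcup_{i\in\mathbb N}(M_i)_D\in\mathrm{data}([\![M]\!]).$$ -/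

import Mathlib

open OmegaCompletePartialOrder

/-! ## The functor of the domain equation

`Layer X` is `(Nil + Left(X) + Right(X) + Pair(X × X) + Amb(X × X) + Fun(X → X))_⊥`, a separated sum
with a new least element. `X →𝒄 X` is the set of maps that preserve suprema of increasing sequences.
The approximations below are finite, so their inverse limit `D` is algebraic with a countable base,
and on it this is the same as Scott continuity (preservation of directed suprema). -/

inductive Layer (X : Type) [OmegaCompletePartialOrder X] : Type
  | bot : Layer X
  | nil : Layer X
  | left (x : X) : Layer X
  | right (x : X) : Layer X
  | pair (x y : X) : Layer X
  | amb (x y : X) : Layer X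
  | fn (f : X →𝒄 X) : Layer X

namespace Layer

section
variable {X : Type} [OmegaCompletePartialOrder X]

inductive Le : Layer X → Layer X → Prop
  | bot (s : Layer X) : Le Layer.bot s
  | nil : Le Layer.nil Layer.nil
  | left {x x' : X} (h : x ≤ x') : Le (Layer.left x) (Layer.left x')
  | right {x x' : X} (h : x ≤ x') : Le (Layer.right x) (Layer.right x')
  | pair {x x' y y' : X} (h : x ≤ x') (k : y ≤ y') : Le (Layer.pair x y) (Layer.pair x' y')
  | amb {x x' y y' : X} (h : x ≤ x') (k : y ≤ y') : Le (Layer.amb x y) (Layer.amb x' y')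
  | fn {f f' : X →𝒄 X} (h : f ≤ f') : Le (Layer.fn f) (Layer.fn f')

instance : PartialOrder (Layer X) where
  le := Le
  le_refl s := by cases s <;> constructor <;> exact le_rfl
  le_trans s t u h k := by
    cases h <;> cases k <;> constructor <;> (apply le_trans <;> assumption)
  le_antisymm s t h k := by
    cases h <;> cases k <;> first | rfl | (congr 1 <;> (apply le_antisymm <;> assumption))

instance : OrderBot (Layer X) where
  bot := Layer.bot
  bot_le := Le.bot

/-- Replace the components of `s`, keeping its constructor. -/
def refill (s : Layer X) (x y : X) (f : X →𝒄 X) : Layer X :=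
  match s with
  | bot => bot
  | nil => nil
  | left _ => left x
  | right _ => right x
  | pair _ _ => pair x y
  | amb _ _ => amb x y
  | fn _ => fn f

theorem refill_mono {s : Layer X} {x x' y y' : X} {f f' : X →𝒄 X} (hx : x ≤ x') (hy : y ≤ y')
    (hf : f ≤ f') : refill s x y f ≤ refill s x' y' f' := by
  cases s <;> constructor <;> assumption

theorem refill_congr {s t : Layer X} (h : s ≤ t) (hs : s ≠ bot) (x y : X) (f : X →𝒄 X) :
    refill s x y f = refill t x y f := by
  cases h <;> first | rfl | exact absurd rfl hs

theorem eq_bot_of_le {s : Layer X} (h : s ≤ bot) : s = bot := by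
  cases h; rfl

variable [OrderBot X]

/-- First component (`⊥` if there is none). -/
def arg1 : Layer X → X
  | left x | right x | pair x _ | amb x _ => x
  | _ => ⊥

/-- Second component (`⊥` if there is none). -/
def arg2 : Layer X → X
  | pair _ y | amb _ y => y
  | _ => ⊥

/-- Function component (constantly `⊥` if there is none). -/
def fnPart : Layer X → (X →𝒄 X)
  | fn f => f
  | _ => ContinuousHom.const ⊥

theorem arg1_mono : Monotone (arg1 : Layer X → X) := by
  intro s t h
  cases h <;> first | exact bot_le | exact le_rfl | assumption

theorem arg2_mono : Monotone (arg2 : Layer X → X) := by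
  intro s t h
  cases h <;> first | exact bot_le | exact le_rfl | assumption

theorem fnPart_mono : Monotone (fnPart : Layer X → (X →𝒄 X)) := by
  intro s t h
  cases h <;> first | exact fun _ => bot_le | exact le_rfl | assumption

theorem refill_self (s : Layer X) : refill s (arg1 s) (arg2 s) (fnPart s) = s := by
  cases s <;> rfl

open Classical in
/-- A chain that is not constantly `⊥` eventually has a fixed constructor, and its supremum is
formed componentwise. -/
noncomputable def lSup (c : Chain (Layer X)) : Layer X :=
  if h : ∃ n, c n ≠ bot then
    refill (c h.choose) (ωSup (c.map ⟨arg1, arg1_mono⟩)) (ωSup (c.map ⟨arg2, arg2_mono⟩))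
      (ωSup (c.map ⟨fnPart, fnPart_mono⟩))
  else bot

theorem lSup_eq (c : Chain (Layer X)) (n : ℕ) (hn : c n ≠ bot) :
    lSup c = refill (c n) (ωSup (c.map ⟨arg1, arg1_mono⟩)) (ωSup (c.map ⟨arg2, arg2_mono⟩))
      (ωSup (c.map ⟨fnPart, fnPart_mono⟩)) := by
  have h : ∃ n, c n ≠ bot := ⟨n, hn⟩
  rw [lSup, dif_pos h]
  rcases le_total h.choose n with hl | hl
  · exact refill_congr (OrderHomClass.mono c hl) h.choose_spec _ _ _
  · exact (refill_congr (OrderHomClass.mono c hl) hn _ _ _).symm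

noncomputable instance : OmegaCompletePartialOrder (Layer X) where
  ωSup := lSup
  le_ωSup c i := by
    by_cases hi : c i = bot
    · rw [hi]; exact Le.bot _
    · rw [lSup_eq c i hi]
      conv_lhs => rw [← refill_self (c i)]
      exact refill_mono (le_ωSup (c.map ⟨arg1, arg1_mono⟩) i)
        (le_ωSup (c.map ⟨arg2, arg2_mono⟩) i) (le_ωSup (c.map ⟨fnPart, fnPart_mono⟩) i)
  ωSup_le c t ht := by
    by_cases h : ∃ n, c n ≠ bot
    · obtain ⟨n, hn⟩ := h
      rw [lSup_eq c n hn, refill_congr (ht n) hn]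
      conv_rhs => rw [← refill_self t]
      exact refill_mono (ωSup_le _ _ fun i => arg1_mono (ht i))
        (ωSup_le _ _ fun i => arg2_mono (ht i)) (ωSup_le _ _ fun i => fnPart_mono (ht i))
    · rw [lSup, dif_neg h]; exact Le.bot _

end

end Layer

/-! ### Continuity of the layer operations -/

namespace Layer

theorem cont_of_le {α β : Type} [OmegaCompletePartialOrder α] [OmegaCompletePartialOrder β]
    {f : α → β} (hm : Monotone f)
    (h : ∀ (c : Chain α) (z : β), (∀ i, f (c i) ≤ z) → f (ωSup c) ≤ z) : ωScottContinuous f := by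
  refine ωScottContinuous.of_monotone_map_ωSup ⟨hm, fun c => le_antisymm ?_ ?_⟩
  · exact h c _ fun i => le_ωSup (c.map ⟨f, hm⟩) i
  · exact ωSup_le _ _ fun i => hm (le_ωSup c i)

section
variable {X : Type} [OmegaCompletePartialOrder X]

theorem bot_eq : (⊥ : Layer X) = Layer.bot := rfl

variable [OrderBot X]

theorem sup_eq (c : Chain (Layer X)) (n : ℕ) (hn : c n ≠ bot) :
    ωSup c = refill (c n) (ωSup (c.map ⟨arg1, arg1_mono⟩)) (ωSup (c.map ⟨arg2, arg2_mono⟩))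
      (ωSup (c.map ⟨fnPart, fnPart_mono⟩)) := lSup_eq c n hn

theorem sup_bot (c : Chain (Layer X)) (h : ∀ n, c n = bot) : ωSup c = bot :=
  eq_bot_of_le (ωSup_le _ _ fun i => (h i).le)

theorem cont_arg1 : ωScottContinuous (arg1 : Layer X → X) := by
  refine cont_of_le arg1_mono fun c z hz => ?_
  by_cases h : ∃ n, c n ≠ bot
  · obtain ⟨n, hn⟩ := h
    rw [sup_eq c n hn]
    cases c n <;> first | exact bot_le | exact ωSup_le _ _ hz
  · push Not at h
    rw [sup_bot c h]; exact bot_le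

theorem cont_arg2 : ωScottContinuous (arg2 : Layer X → X) := by
  refine cont_of_le arg2_mono fun c z hz => ?_
  by_cases h : ∃ n, c n ≠ bot
  · obtain ⟨n, hn⟩ := h
    rw [sup_eq c n hn]
    cases c n <;> first | exact bot_le | exact ωSup_le _ _ hz
  · push Not at h
    rw [sup_bot c h]; exact bot_le

theorem cont_fnPart : ωScottContinuous (fnPart : Layer X → (X →𝒄 X)) := by
  refine cont_of_le fnPart_mono fun c z hz => ?_
  by_cases h : ∃ n, c n ≠ bot
  · obtain ⟨n, hn⟩ := h
    rw [sup_eq c n hn]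
    cases c n <;> first | exact fun _ => bot_le | exact ωSup_le _ _ hz
  · push Not at h
    rw [sup_bot c h]; exact fun _ => bot_le

/-- A case distinction on the constructor of `s a` is continuous if each branch is. -/
theorem cont_cases {α β : Type} [OmegaCompletePartialOrder α] [OmegaCompletePartialOrder β]
    [OrderBot β] {s : α → Layer X} (hs : ωScottContinuous s) (k : Layer X → α → β)
    (hk : ∀ t, ωScottContinuous (k t)) (hb : ∀ a, k bot a = ⊥)
    (hr : ∀ t x y f, k (refill t x y f) = k t) : ωScottContinuous (fun a => k (s a) a) := by
  have hle : ∀ t t', t ≤ t' → t ≠ bot → k t = k t' := by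
    intro t t' h hn
    rw [← refill_self t', ← refill_congr h hn, hr]
  refine cont_of_le ?_ fun c z hz => ?_
  · intro a a' h
    by_cases hn : s a = bot
    · simp only [hn, hb]; exact bot_le
    · simp only [hle _ _ (hs.monotone h) hn]
      exact (hk _).monotone h
  · by_cases h : ∃ n, s (c n) ≠ bot
    · obtain ⟨n, hn⟩ := h
      have e : k (s (ωSup c)) = k (s (c n)) := (hle _ _ (hs.monotone (le_ωSup c n)) hn).symm
      simp only [e]
      rw [(hk _).map_ωSup]
      refine ωSup_le _ _ fun i => ?_
      have h1 : c i ≤ c (max n i) := OrderHomClass.mono c (le_max_right _ _)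
      have h2 : c n ≤ c (max n i) := OrderHomClass.mono c (le_max_left _ _)
      refine ((hk _).monotone h1).trans ?_
      rw [hle _ _ (hs.monotone h2) hn]
      exact hz _
    · push Not at h
      have e : s (ωSup c) = bot := by
        rw [hs.map_ωSup]; exact sup_bot _ h
      simp only [e, hb]; exact bot_le

theorem cont_left {α : Type} [OmegaCompletePartialOrder α] {x : α → X} (hx : ωScottContinuous x) :
    ωScottContinuous (fun a => left (x a)) := by
  refine cont_of_le (fun a b h => Le.left (hx.monotone h)) fun c z hz => ?_
  rw [← refill_self z, ← refill_congr (hz 0) nofun, hx.map_ωSup]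
  exact Le.left (ωSup_le _ _ fun i => arg1_mono (hz i))

theorem cont_right {α : Type} [OmegaCompletePartialOrder α] {x : α → X} (hx : ωScottContinuous x) :
    ωScottContinuous (fun a => right (x a)) := by
  refine cont_of_le (fun a b h => Le.right (hx.monotone h)) fun c z hz => ?_
  rw [← refill_self z, ← refill_congr (hz 0) nofun, hx.map_ωSup]
  exact Le.right (ωSup_le _ _ fun i => arg1_mono (hz i))

theorem cont_pair {α : Type} [OmegaCompletePartialOrder α] {x y : α → X}
    (hx : ωScottContinuous x) (hy : ωScottContinuous y) :
    ωScottContinuous (fun a => pair (x a) (y a)) := by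
  refine cont_of_le (fun a b h => Le.pair (hx.monotone h) (hy.monotone h)) fun c z hz => ?_
  rw [← refill_self z, ← refill_congr (hz 0) nofun, hx.map_ωSup, hy.map_ωSup]
  exact Le.pair (ωSup_le _ _ fun i => arg1_mono (hz i)) (ωSup_le _ _ fun i => arg2_mono (hz i))

theorem cont_amb {α : Type} [OmegaCompletePartialOrder α] {x y : α → X}
    (hx : ωScottContinuous x) (hy : ωScottContinuous y) :
    ωScottContinuous (fun a => amb (x a) (y a)) := by
  refine cont_of_le (fun a b h => Le.amb (hx.monotone h) (hy.monotone h)) fun c z hz => ?_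
  rw [← refill_self z, ← refill_congr (hz 0) nofun, hx.map_ωSup, hy.map_ωSup]
  exact Le.amb (ωSup_le _ _ fun i => arg1_mono (hz i)) (ωSup_le _ _ fun i => arg2_mono (hz i))

theorem cont_fn {α : Type} [OmegaCompletePartialOrder α] {f : α → (X →𝒄 X)}
    (hf : ωScottContinuous f) : ωScottContinuous (fun a => fn (f a)) := by
  refine cont_of_le (fun a b h => Le.fn (hf.monotone h)) fun c z hz => ?_
  rw [← refill_self z, ← refill_congr (hz 0) nofun, hf.map_ωSup]
  exact Le.fn (ωSup_le _ _ fun i => fnPart_mono (hz i))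

end

section
variable {X Y Z : Type} [OmegaCompletePartialOrder X] [OmegaCompletePartialOrder Y]
  [OmegaCompletePartialOrder Z]

/-- The action of `Layer` on a pair of maps (mixed variance, because of the function summand). -/
def map (e : X →𝒄 Y) (p : Y →𝒄 X) : Layer X → Layer Y
  | bot => bot
  | nil => nil
  | left x => left (e x)
  | right x => right (e x)
  | pair x y => pair (e x) (e y)
  | amb x y => amb (e x) (e y)
  | fn f => fn (e.comp (f.comp p))

theorem map_map (e : X →𝒄 Y) (p : Y →𝒄 X) (e' : Y →𝒄 Z) (p' : Z →𝒄 Y) (s : Layer X) :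
    map e' p' (map e p s) = map (e'.comp e) (p.comp p') s := by
  cases s <;> rfl

theorem map_id (s : Layer X) : map ContinuousHom.id ContinuousHom.id s = s := by
  cases s <;> rfl

theorem map_mono {e e' : X →𝒄 Y} {p p' : Y →𝒄 X} (he : e ≤ e') (hp : p ≤ p') (s : Layer X) :
    map e p s ≤ map e' p' s := by
  cases s <;> constructor <;> first | exact he _ | skip
  intro y
  exact (he _).trans (e'.monotone (ContinuousHom.monotone _ (hp y)))

theorem cont_map [OrderBot X] (e : X →𝒄 Y) (p : Y →𝒄 X) [OrderBot Y] :
    ωScottContinuous (map e p) := by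
  have h1 : ωScottContinuous (fun s : Layer X => e (arg1 s)) := e.ωScottContinuous.comp cont_arg1
  have h2 : ωScottContinuous (fun s : Layer X => e (arg2 s)) := e.ωScottContinuous.comp cont_arg2
  have h3 : ωScottContinuous (fun s : Layer X => e.comp ((fnPart s).comp p)) := by
    refine cont_of_le (fun a b h y => e.monotone (fnPart_mono h (p y))) fun c z hz y => ?_
    change e (fnPart (ωSup c) (p y)) ≤ z y
    have : ωScottContinuous (fun s : Layer X => e (fnPart s (p y))) :=
      e.ωScottContinuous.comp
        (ContinuousHom.ωScottContinuous_apply cont_fnPart ωScottContinuous.const)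
    rw [this.map_ωSup]
    exact ωSup_le _ _ fun i => hz i y
  have := cont_cases (s := (fun s : Layer X => s)) ωScottContinuous.fun_id
    (fun t s => match t with
      | bot => (⊥ : Layer Y)
      | nil => nil
      | left _ => left (e (arg1 s))
      | right _ => right (e (arg1 s))
      | pair _ _ => pair (e (arg1 s)) (e (arg2 s))
      | amb _ _ => amb (e (arg1 s)) (e (arg2 s))
      | fn _ => fn (e.comp ((fnPart s).comp p)))
    (by
      intro t
      cases t
      · exact ωScottContinuous.const
      · exact ωScottContinuous.const
      · exact cont_left h1
      · exact cont_right h1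
      · exact cont_pair h1 h2
      · exact cont_amb h1 h2
      · exact cont_fn h3)
    (fun _ => rfl) (by intro t x y f; cases t <;> rfl)
  convert this using 1
  funext s
  cases s <;> rfl

/-- `map` as a continuous function. -/
noncomputable def mapHom [OrderBot X] [OrderBot Y] (e : X →𝒄 Y) (p : Y →𝒄 X) : Layer X →𝒄 Layer Y :=
  ContinuousHom.ofFun (map e p) (cont_map e p)

end

end Layer

/-! ## The domain `D`: the inverse limit of the finite approximations -/

/-- A pointed `ω`-cpo. -/
structure PCpo where
  carrier : Type
  [cpo : OmegaCompletePartialOrder carrier]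
  [pointed : OrderBot carrier]

attribute [instance] PCpo.cpo PCpo.pointed

/-- `Approx 0 = {⊥}` and `Approx (n+1) = Layer (Approx n)`. -/
noncomputable def Approx : ℕ → PCpo
  | 0 =>
    { carrier := Unit
      cpo :=
        { ωSup := fun _ => ()
          le_ωSup := fun _ _ => trivial
          ωSup_le := fun _ _ _ => trivial } }
  | n + 1 => { carrier := Layer (Approx n).carrier }

abbrev Apx (n : ℕ) : Type := (Approx n).carrier

/-- The identity, read as a map between the two names `Apx (n+1)` and `Layer (Apx n)` of one type. -/
def unpack {n : ℕ} (x : Apx (n + 1)) : Layer (Apx n) := x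

/-- The identity, read as a map between the two names `Layer (Apx n)` and `Apx (n+1)` of one type. -/
def pack {n : ℕ} (s : Layer (Apx n)) : Apx (n + 1) := s

theorem unpack_pack {n : ℕ} (s : Layer (Apx n)) : unpack (pack s) = s := rfl

theorem pack_unpack {n : ℕ} (x : Apx (n + 1)) : pack (unpack x) = x := rfl

theorem pack_mono {n : ℕ} : Monotone (pack : Layer (Apx n) → Apx (n + 1)) := fun _ _ h => h

theorem unpack_mono {n : ℕ} : Monotone (unpack : Apx (n + 1) → Layer (Apx n)) := fun _ _ h => h

/-- The canonical maps `Apx n → Apx m` and `Apx m → Apx n` (embedding one way, projection the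
other). -/
noncomputable def links : (n m : ℕ) → (Apx n →𝒄 Apx m) × (Apx m →𝒄 Apx n)
  | 0, _ => (ContinuousHom.const ⊥, ContinuousHom.const ⊥)
  | _ + 1, 0 => (ContinuousHom.const ⊥, ContinuousHom.const ⊥)
  | n + 1, m + 1 =>
    (Layer.mapHom (links n m).1 (links n m).2, Layer.mapHom (links n m).2 (links n m).1)

noncomputable def link (n m : ℕ) : Apx n →𝒄 Apx m := (links n m).1

theorem apx_zero (x y : Apx 0) : x = y := by
  change Unit at x y
  rfl

theorem links_swap : ∀ n m : ℕ, links m n = ((links n m).2, (links n m).1)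
  | 0, 0 => rfl
  | 0, _ + 1 => rfl
  | _ + 1, 0 => rfl
  | n + 1, m + 1 => by
    change (Layer.mapHom (links m n).1 (links m n).2, Layer.mapHom (links m n).2 (links m n).1) =
      (Layer.mapHom (links n m).2 (links n m).1, Layer.mapHom (links n m).1 (links n m).2)
    rw [links_swap n m]

theorem link_succ (n m : ℕ) (x : Apx (n + 1)) :
    link (n + 1) (m + 1) x = pack (Layer.map (link n m) (link m n) (unpack x)) := by
  have h : link m n = (links n m).2 := by rw [link, links_swap n m]
  rw [h]; rfl

theorem link_bot : ∀ n m : ℕ, link n m ⊥ = ⊥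
  | 0, _ => rfl
  | _ + 1, 0 => apx_zero _ _
  | n + 1, m + 1 => by rw [link_succ]; rfl

theorem link_zero (m : ℕ) (x : Apx 0) : link 0 m x = ⊥ := by
  rw [apx_zero x ⊥, link_bot]

theorem link_self : ∀ (n : ℕ), link n n = ContinuousHom.id
  | 0 => by ext x; exact apx_zero _ _
  | n + 1 => by
    ext x
    rw [link_succ, link_self n, Layer.map_id]
    rfl

theorem link_link_le : ∀ (n k m : ℕ), (link k m).comp (link n k) ≤ link n m
  | 0, k, m => fun x => by
    change link k m (link 0 k x) ≤ _
    rw [link_zero, link_bot]; exact bot_le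
  | n + 1, 0, m => fun x => by
    change link 0 m (link (n + 1) 0 x) ≤ _
    rw [link_zero]; exact bot_le
  | n + 1, k + 1, 0 => fun x => (apx_zero _ _).le
  | n + 1, k + 1, m + 1 => fun x => by
    change link (k + 1) (m + 1) (link (n + 1) (k + 1) x) ≤ _
    change _ ≤ link (n + 1) (m + 1) x
    rw [link_succ, link_succ, link_succ, unpack_pack, Layer.map_map]
    exact pack_mono (Layer.map_mono (link_link_le n k m) (link_link_le m k n) _)

theorem link_link : ∀ (n k m : ℕ), n ≤ k ∨ m ≤ k → (link k m).comp (link n k) = link n m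
  | 0, k, m, _ => by
    ext x
    change link k m (link 0 k x) = _
    rw [link_zero, link_bot, link_zero]
  | n + 1, 0, m, h => by
    obtain rfl : m = 0 := by omega
    ext x
    exact apx_zero _ _
  | n + 1, k + 1, 0, _ => by ext x; exact apx_zero _ _
  | n + 1, k + 1, m + 1, h => by
    ext x
    change link (k + 1) (m + 1) (link (n + 1) (k + 1) x) = _
    rw [link_succ, link_succ, link_succ, unpack_pack, Layer.map_map, link_link n k m (by omega),
      link_link m k n (by omega)]

theorem link_link_apply {n k m : ℕ} (h : n ≤ k ∨ m ≤ k) (x : Apx n) :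
    link k m (link n k x) = link n m x :=
  ContinuousHom.congr_fun (link_link n k m h) x

/-- The Scott domain `D`, as the inverse limit of the finite approximations: coherent sequences,
ordered componentwise. It is the canonical (initial) solution of the domain equation;
`D.isoLayer` below is the isomorphism. -/
def D : Type := {x : (n : ℕ) → Apx n // ∀ n m, n ≤ m → link m n (x m) = x n}

namespace D

noncomputable instance : OmegaCompletePartialOrder D :=
  OmegaCompletePartialOrder.subtype _ (by
    intro c hc n m h
    change link m n (ωSup _) = ωSup _
    rw [(link m n).continuous]
    congr 1
    ext i
    exact hc (c i) ⟨i, rfl⟩ n m h)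

noncomputable instance : OrderBot D where
  bot := ⟨fun _ => ⊥, fun _ _ _ => link_bot _ _⟩
  bot_le _ _ := bot_le

/-- The projection of `D` to the `n`-th approximation. -/
noncomputable def proj (n : ℕ) : D →𝒄 Apx n where
  toFun x := x.1 n
  monotone' _ _ h := h n
  map_ωSup' _ := rfl

theorem le_of_proj {x y : D} (h : ∀ n, proj n x ≤ proj n y) : x ≤ y := h

theorem eq_of_proj {x y : D} (h : ∀ n, proj n x = proj n y) : x = y := Subtype.ext (funext h)

theorem link_proj {n m : ℕ} (h : n ≤ m) (x : D) : link m n (proj m x) = proj n x := x.2 n m h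

/-- The embedding of the `n`-th approximation into `D`. -/
noncomputable def emb (n : ℕ) : Apx n →𝒄 D where
  toFun x := ⟨fun m => link n m x, fun _ _ h => link_link_apply (Or.inr h) x⟩
  monotone' _ _ h m := (link n m).monotone h
  map_ωSup' c := eq_of_proj fun m => (link n m).continuous c

theorem proj_emb (n m : ℕ) (x : Apx n) : proj m (emb n x) = link n m x := rfl

theorem proj_comp_emb (n m : ℕ) : (proj m).comp (emb n) = link n m := rfl

theorem link_proj_le (n m : ℕ) (x : D) : link n m (proj n x) ≤ proj m x := by
  rcases le_total m n with h | h
  · exact (link_proj h x).le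
  · rw [← link_proj h x]
    refine (link_link_le m n m _).trans ?_
    rw [link_self]; exact le_rfl

theorem emb_link_le (n m : ℕ) : (emb m).comp (link n m) ≤ emb n :=
  fun x k => link_link_le n m k x

/-- The chain `emb n (proj n x)`, whose supremum is `x`. -/
theorem emb_proj_le (n : ℕ) (x : D) : emb n (proj n x) ≤ x := fun m => link_proj_le n m x

theorem emb_proj_mono {n m : ℕ} (h : n ≤ m) (x : D) : emb n (proj n x) ≤ emb m (proj m x) := by
  intro k
  change link n k (proj n x) ≤ link m k (proj m x)
  rw [← link_proj h x]
  exact link_link_le m n k _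

theorem le_of_emb_proj {x y : D} (h : ∀ n, emb n (proj n x) ≤ y) : x ≤ y := fun n => by
  have := h n n
  change link n n (proj n x) ≤ _ at this
  rwa [link_self] at this

/-- From a layer over `D` to `D`: one half of the isomorphism. -/
noncomputable def roll (s : Layer D) : D :=
  ⟨fun n => match n with
    | 0 => ⊥
    | n + 1 => pack (Layer.map (proj n) (emb n) s), by
    intro n m h
    cases n with
    | zero => exact apx_zero _ _
    | succ n =>
      cases m with
      | zero => omega
      | succ m =>
        change link (m + 1) (n + 1) (pack (Layer.map _ _ s)) = pack (Layer.map _ _ s)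
        rw [link_succ, unpack_pack, Layer.map_map]
        congr 2
        · ext x; exact link_proj (by omega) x
        · ext x
          exact eq_of_proj fun k => link_link_apply (Or.inl (by omega)) x⟩

theorem proj_roll (n : ℕ) (s : Layer D) :
    proj (n + 1) (roll s) = pack (Layer.map (proj n) (emb n) s) := rfl

theorem unroll_mono (x : D) :
    Monotone (fun n => Layer.map (emb n) (proj n) (unpack (proj (n + 1) x)) : ℕ → Layer D) := by
  refine monotone_nat_of_le_succ fun n => ?_
  rw [← link_proj (Nat.le_succ (n + 1)) x, link_succ, unpack_pack, Layer.map_map]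
  exact Layer.map_mono (emb_link_le _ _) (fun y => link_proj_le _ _ y) _

/-- From `D` to a layer over `D`: the other half of the isomorphism. -/
noncomputable def unroll (x : D) : Layer D :=
  ωSup ⟨⟨fun n => Layer.map (emb n) (proj n) (unpack (proj (n + 1) x)), unroll_mono x⟩⟩

theorem cont_roll : ωScottContinuous roll := by
  refine Layer.cont_of_le ?_ fun c z hz => ?_
  · intro s t h n
    cases n with
    | zero => exact (apx_zero _ _).le
    | succ n => exact (Layer.cont_map (proj n) (emb n)).monotone h
  · intro n
    cases n with
    | zero => exact (apx_zero _ _).le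
    | succ n =>
      change Layer.map (proj n) (emb n) (ωSup c) ≤ _
      rw [(Layer.cont_map (proj n) (emb n)).map_ωSup]
      exact ωSup_le _ _ fun i => hz i (n + 1)

theorem unroll_monotone : Monotone unroll := fun _ _ h =>
  ωSup_le_ωSup_of_le fun n => ⟨n, (Layer.cont_map (emb n) (proj n)).monotone (h (n + 1))⟩

theorem roll_unroll (x : D) : roll (unroll x) = x := by
  refine le_antisymm ?_ ?_
  · rw [unroll, cont_roll.map_ωSup]
    refine ωSup_le _ _ fun k n => ?_
    cases n with
    | zero => exact (apx_zero _ _).le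
    | succ n =>
      change pack (Layer.map (proj n) (emb n)
        (Layer.map (emb k) (proj k) (unpack (proj (k + 1) x)))) ≤ _
      rw [Layer.map_map, proj_comp_emb, proj_comp_emb, ← link_succ]
      exact link_proj_le _ _ x
  · intro n
    cases n with
    | zero => exact (apx_zero _ _).le
    | succ n =>
      have h : Layer.map (emb n) (proj n) (unpack (proj (n + 1) x)) ≤ unroll x :=
        le_ωSup ⟨⟨fun n => Layer.map (emb n) (proj n) (unpack (proj (n + 1) x)), unroll_mono x⟩⟩ n
      have h2 := (Layer.cont_map (proj n) (emb n)).monotone h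
      rw [Layer.map_map, proj_comp_emb, link_self, Layer.map_id] at h2
      exact pack_mono h2

theorem le_of_map_emb_proj {s t : Layer D}
    (h : ∀ n, Layer.map ((emb n).comp (proj n)) ((emb n).comp (proj n)) s ≤ t) : s ≤ t := by
  have h0 := h 0
  cases s <;> cases h0
  · exact Layer.Le.bot _
  · exact Layer.Le.nil
  · refine Layer.Le.left (le_of_emb_proj fun n => ?_)
    cases h n; assumption
  · refine Layer.Le.right (le_of_emb_proj fun n => ?_)
    cases h n; assumption
  · refine Layer.Le.pair (le_of_emb_proj fun n => ?_) (le_of_emb_proj fun n => ?_) <;>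
      (cases h n; assumption)
  · refine Layer.Le.amb (le_of_emb_proj fun n => ?_) (le_of_emb_proj fun n => ?_) <;>
      (cases h n; assumption)
  · rename_i f g _
    have hn : ∀ n d, emb n (proj n (f (emb n (proj n d)))) ≤ g d := by
      intro n
      cases h n; assumption
    refine Layer.Le.fn fun d => le_of_emb_proj fun m => ?_
    let c : Chain D := ⟨⟨fun n => emb n (proj n d), fun _ _ h => emb_proj_mono h d⟩⟩
    have hd : d = ωSup c := le_antisymm (le_of_emb_proj fun n => le_ωSup c n)
      (ωSup_le _ _ fun n => emb_proj_le n d)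
    change emb m (proj m (f d)) ≤ g d
    conv_lhs => rw [hd]
    rw [f.continuous, (proj m).continuous, (emb m).continuous]
    refine ωSup_le _ _ fun k => ?_
    refine le_trans ?_ (hn (max m k) d)
    refine (emb_proj_mono (le_max_left m k) _).trans ?_
    exact (emb _).monotone ((proj _).monotone (f.monotone (emb_proj_mono (le_max_right m k) d)))

theorem unroll_roll (s : Layer D) : unroll (roll s) = s := by
  refine le_antisymm (ωSup_le _ _ fun n => ?_) (le_of_map_emb_proj fun n => ?_)
  · change Layer.map (emb n) (proj n) (Layer.map (proj n) (emb n) s) ≤ s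
    rw [Layer.map_map]
    calc _ ≤ Layer.map ContinuousHom.id ContinuousHom.id s :=
          Layer.map_mono (emb_proj_le n) (emb_proj_le n) s
      _ = s := Layer.map_id s
  · rw [← Layer.map_map]
    exact le_ωSup ⟨⟨fun n => Layer.map (emb n) (proj n) (unpack (proj (n + 1) (roll s))),
      unroll_mono (roll s)⟩⟩ n

/-- `D` solves the domain equation:
`D ≃ (Nil + Left(D) + Right(D) + Pair(D × D) + Amb(D × D) + Fun(D → D))_⊥`. -/
noncomputable def isoLayer : D ≃o Layer D where
  toFun := unroll
  invFun := roll
  left_inv := roll_unroll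
  right_inv := unroll_roll
  map_rel_iff' := by
    intro x y
    refine ⟨fun (h : unroll x ≤ unroll y) => ?_, fun h => unroll_monotone h⟩
    rw [← roll_unroll x, ← roll_unroll y]
    exact cont_roll.monotone h

end D

/-! ## Programs

Programs in de Bruijn form: `Prog n` is the set of programs with free variables among
`0, …, n-1`, up to renaming of bound variables; `Prog 0` is the set of closed programs. The
innermost binder is variable `0`; in a clause `Pair(a,b) → N` or `Amb(a,b) → N`, `b` is variable `0`
and `a` is variable `1`. -/

inductive Prog : ℕ → Type
  | var {n : ℕ} (i : Fin n) : Prog n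
  | lam {n : ℕ} (M : Prog (n + 1)) : Prog n
  | app {n : ℕ} (M N : Prog n) : Prog n
  /-- strict application `M ↓ N` -/
  | sapp {n : ℕ} (M N : Prog n) : Prog n
  /-- the recursion operator `rec M` -/
  | fix {n : ℕ} (M : Prog n) : Prog n
  | bot {n : ℕ} : Prog n
  | nil {n : ℕ} : Prog n
  | left {n : ℕ} (M : Prog n) : Prog n
  | right {n : ℕ} (M : Prog n) : Prog n
  | pair {n : ℕ} (M N : Prog n) : Prog n
  | amb {n : ℕ} (M N : Prog n) : Prog n
  /-- `case M {Left(a) → L; Right(b) → R}` -/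
  | caseLR {n : ℕ} (M : Prog n) (L R : Prog (n + 1)) : Prog n
  /-- `case M {Pair(a,b) → N}` -/
  | casePair {n : ℕ} (M : Prog n) (N : Prog (n + 2)) : Prog n
  /-- `case M {Amb(a,b) → N}` -/
  | caseAmb {n : ℕ} (M : Prog n) (N : Prog (n + 2)) : Prog n

/-- Extend an assignment by a value for a new variable `0`. -/
def extend {α : Type} {n : ℕ} (x : α) (η : Fin n → α) : Fin (n + 1) → α :=
  Fin.cons (α := fun _ => α) x η

namespace Prog

def rename : {n m : ℕ} → (Fin n → Fin m) → Prog n → Prog m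
  | _, _, ρ, var i => var (ρ i)
  | _, _, ρ, lam M => lam (rename (extend 0 (Fin.succ ∘ ρ)) M)
  | _, _, ρ, app M N => app (rename ρ M) (rename ρ N)
  | _, _, ρ, sapp M N => sapp (rename ρ M) (rename ρ N)
  | _, _, ρ, fix M => fix (rename ρ M)
  | _, _, _, bot => bot
  | _, _, _, nil => nil
  | _, _, ρ, left M => left (rename ρ M)
  | _, _, ρ, right M => right (rename ρ M)
  | _, _, ρ, pair M N => pair (rename ρ M) (rename ρ N)
  | _, _, ρ, amb M N => amb (rename ρ M) (rename ρ N)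
  | _, _, ρ, caseLR M L R =>
    caseLR (rename ρ M) (rename (extend 0 (Fin.succ ∘ ρ)) L) (rename (extend 0 (Fin.succ ∘ ρ)) R)
  | _, _, ρ, casePair M N =>
    casePair (rename ρ M) (rename (extend 0 (Fin.succ ∘ extend 0 (Fin.succ ∘ ρ))) N)
  | _, _, ρ, caseAmb M N =>
    caseAmb (rename ρ M) (rename (extend 0 (Fin.succ ∘ extend 0 (Fin.succ ∘ ρ))) N)

/-- A substitution under a binder. -/
def lift {n m : ℕ} (σ : Fin n → Prog m) : Fin (n + 1) → Prog (m + 1) :=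
  extend (var 0) (fun i => rename Fin.succ (σ i))

/-- Simultaneous capture-avoiding substitution. -/
def subst : {n m : ℕ} → (Fin n → Prog m) → Prog n → Prog m
  | _, _, σ, var i => σ i
  | _, _, σ, lam M => lam (subst (lift σ) M)
  | _, _, σ, app M N => app (subst σ M) (subst σ N)
  | _, _, σ, sapp M N => sapp (subst σ M) (subst σ N)
  | _, _, σ, fix M => fix (subst σ M)
  | _, _, _, bot => bot
  | _, _, _, nil => nil
  | _, _, σ, left M => left (subst σ M)
  | _, _, σ, right M => right (subst σ M)
  | _, _, σ, pair M N => pair (subst σ M) (subst σ N)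
  | _, _, σ, amb M N => amb (subst σ M) (subst σ N)
  | _, _, σ, caseLR M L R => caseLR (subst σ M) (subst (lift σ) L) (subst (lift σ) R)
  | _, _, σ, casePair M N => casePair (subst σ M) (subst (lift (lift σ)) N)
  | _, _, σ, caseAmb M N => caseAmb (subst σ M) (subst (lift (lift σ)) N)

/-- `M[N/a]` for the innermost variable `a`. -/
def inst {n : ℕ} (M : Prog (n + 1)) (N : Prog n) : Prog n := subst (extend N var) M

/-- `M[P/a, Q/b]` for the two innermost variables `a, b` (`b` is variable `0`). -/
def inst₂ {n : ℕ} (M : Prog (n + 2)) (P Q : Prog n) : Prog n :=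
  subst (extend Q (extend P var)) M

end Prog

/-! ## Denotational semantics of programs -/

namespace D

noncomputable def nil : D := roll Layer.nil
noncomputable def left (a : D) : D := roll (Layer.left a)
noncomputable def right (a : D) : D := roll (Layer.right a)
noncomputable def pair (a b : D) : D := roll (Layer.pair a b)
noncomputable def amb (a b : D) : D := roll (Layer.amb a b)
noncomputable def fn (f : D →𝒄 D) : D := roll (Layer.fn f)

/-- `f(d)` if `a = Fun(f)`. -/
noncomputable def app (a d : D) : D :=
  match unroll a with
  | .fn f => f d
  | _ => ⊥

open Classical in
/-- `f(d)` if `a = Fun(f)` and `d ≠ ⊥`. -/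
noncomputable def sapp (a d : D) : D := if d = ⊥ then ⊥ else app a d

/-- The least fixed point of a continuous function. -/
noncomputable def lfp (f : D →𝒄 D) : D := ωSup (fixedPoints.iterateChain f ⊥ bot_le)

theorem lfp_isLeast (f : D →𝒄 D) : IsLeast {d | f d = d} (lfp f) :=
  ⟨fixedPoints.ωSup_iterate_mem_fixedPoint f ⊥ bot_le, fun _ h =>
    fixedPoints.ωSup_iterate_le_fixedPoint f ⊥ bot_le h bot_le⟩

/-- The least fixed point of `f` if `a = Fun(f)`. -/
noncomputable def fix (a : D) : D :=
  match unroll a with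
  | .fn f => lfp f
  | _ => ⊥

/-- `l(d)` if `a = Left(d)`, and `r(d)` if `a = Right(d)`. -/
noncomputable def caseLR (a : D) (l r : D → D) : D :=
  match unroll a with
  | .left d => l d
  | .right d => r d
  | _ => ⊥

/-- `g(d,e)` if `a = Pair(d,e)`. -/
noncomputable def casePair (a : D) (g : D → D → D) : D :=
  match unroll a with
  | .pair d e => g d e
  | _ => ⊥

/-- `g(d,e)` if `a = Amb(d,e)`. -/
noncomputable def caseAmb (a : D) (g : D → D → D) : D :=
  match unroll a with
  | .amb d e => g d e
  | _ => ⊥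

/-! ### Continuity -/

theorem cont_unroll : ωScottContinuous unroll := by
  refine Layer.cont_of_le unroll_monotone fun c z hz => ?_
  rw [← unroll_roll z]
  refine unroll_monotone (ωSup_le _ _ fun i => ?_)
  rw [← roll_unroll (c i)]
  exact cont_roll.monotone (hz i)

section
variable {α : Type} [OmegaCompletePartialOrder α] {a b : α → D}

theorem cont_left (ha : ωScottContinuous a) : ωScottContinuous (fun x => left (a x)) :=
  cont_roll.comp (Layer.cont_left ha)

theorem cont_right (ha : ωScottContinuous a) : ωScottContinuous (fun x => right (a x)) :=
  cont_roll.comp (Layer.cont_right ha)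

theorem cont_pair (ha : ωScottContinuous a) (hb : ωScottContinuous b) :
    ωScottContinuous (fun x => pair (a x) (b x)) :=
  cont_roll.comp (Layer.cont_pair ha hb)

theorem cont_amb (ha : ωScottContinuous a) (hb : ωScottContinuous b) :
    ωScottContinuous (fun x => amb (a x) (b x)) :=
  cont_roll.comp (Layer.cont_amb ha hb)

theorem cont_fn {f : α → (D →𝒄 D)} (hf : ωScottContinuous f) :
    ωScottContinuous (fun x => fn (f x)) :=
  cont_roll.comp (Layer.cont_fn hf)

theorem cont_app (ha : ωScottContinuous a) (hb : ωScottContinuous b) :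
    ωScottContinuous (fun x => app (a x) (b x)) := by
  have h : ωScottContinuous (fun x => Layer.fnPart (unroll (a x)) (b x)) :=
    ContinuousHom.ωScottContinuous_apply (Layer.cont_fnPart.comp (cont_unroll.comp ha)) hb
  convert h using 1
  funext x
  rw [app]
  cases unroll (a x) <;> rfl

theorem unroll_eq_bot {d : D} : unroll d = Layer.bot ↔ d = ⊥ := by
  have h : unroll ⊥ = Layer.bot := Layer.eq_bot_of_le (by
    rw [← unroll_roll Layer.bot]; exact unroll_monotone bot_le)
  refine ⟨fun e => ?_, fun e => e ▸ h⟩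
  rw [← roll_unroll d, e, ← h, roll_unroll]

theorem cont_sapp (ha : ωScottContinuous a) (hb : ωScottContinuous b) :
    ωScottContinuous (fun x => sapp (a x) (b x)) := by
  have := Layer.cont_cases (cont_unroll.comp hb)
    (fun t x => match t with
      | .bot => (⊥ : D)
      | _ => app (a x) (b x))
    (by intro t; cases t <;> first | exact ωScottContinuous.const | exact cont_app ha hb)
    (fun _ => rfl) (by intro t x y f; cases t <;> rfl)
  convert this using 1
  funext x
  by_cases h : b x = ⊥
  · have h' : unroll (b x) = Layer.bot := unroll_eq_bot.2 h
    rw [sapp, if_pos h, Function.comp, h']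
  · have h' : unroll (b x) ≠ Layer.bot := fun e => h (unroll_eq_bot.1 e)
    rw [sapp, if_neg h, Function.comp]
    cases e : unroll (b x) <;> first | rfl | exact absurd e h'

theorem cont_lfp : ωScottContinuous lfp := by
  have fixed : ∀ f : D →𝒄 D, f (lfp f) = lfp f := fun f => (lfp_isLeast f).1
  have hm : Monotone lfp := fun f g h =>
    fixedPoints.ωSup_iterate_le_prefixedPoint f ⊥ bot_le
      ((h _).trans (fixed g).le) bot_le
  refine Layer.cont_of_le hm fun c z hz => ?_
  refine le_trans (fixedPoints.ωSup_iterate_le_prefixedPoint (ωSup c) ⊥ bot_le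
    (a := ωSup (c.map ⟨lfp, hm⟩)) ?_ bot_le) (ωSup_le _ _ hz)
  rw [ContinuousHom.ωSup_apply_ωSup, ContinuousHom.continuous]
  refine ωSup_le _ _ fun i => ?_
  exact (fixed (c i)).le.trans (le_ωSup (c.map ⟨lfp, hm⟩) i)

theorem cont_fix (ha : ωScottContinuous a) : ωScottContinuous (fun x => fix (a x)) := by
  have := Layer.cont_cases (cont_unroll.comp ha)
    (fun t x => match t with
      | .fn _ => lfp (Layer.fnPart (unroll (a x)))
      | _ => (⊥ : D))
    (by
      intro t
      cases t <;> first
        | exact ωScottContinuous.const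
        | exact cont_lfp.comp (Layer.cont_fnPart.comp (cont_unroll.comp ha)))
    (fun _ => rfl) (by intro t x y f; cases t <;> rfl)
  convert this using 1
  funext x
  rw [fix, Function.comp]
  cases unroll (a x) <;> rfl

theorem cont_caseLR {l r : α → D → D} (ha : ωScottContinuous a)
    (hl : ωScottContinuous (fun p : α × D => l p.1 p.2))
    (hr : ωScottContinuous (fun p : α × D => r p.1 p.2)) :
    ωScottContinuous (fun x => caseLR (a x) (l x) (r x)) := by
  have h1 : ωScottContinuous (fun x => Layer.arg1 (unroll (a x))) :=
    Layer.cont_arg1.comp (cont_unroll.comp ha)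
  have := Layer.cont_cases (cont_unroll.comp ha)
    (fun t x => match t with
      | .left _ => l x (Layer.arg1 (unroll (a x)))
      | .right _ => r x (Layer.arg1 (unroll (a x)))
      | _ => (⊥ : D))
    (by
      intro t
      cases t <;> first
        | exact ωScottContinuous.const
        | exact hl.comp (Prod.ωScottContinuous.prodMk ωScottContinuous.fun_id h1)
        | exact hr.comp (Prod.ωScottContinuous.prodMk ωScottContinuous.fun_id h1))
    (fun _ => rfl) (by intro t x y f; cases t <;> rfl)
  convert this using 1
  funext x
  rw [caseLR, Function.comp]
  cases unroll (a x) <;> rfl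

theorem cont_casePair {g : α → D → D → D} (ha : ωScottContinuous a)
    (hg : ωScottContinuous (fun p : α × D × D => g p.1 p.2.1 p.2.2)) :
    ωScottContinuous (fun x => casePair (a x) (g x)) := by
  have h1 : ωScottContinuous (fun x => Layer.arg1 (unroll (a x))) :=
    Layer.cont_arg1.comp (cont_unroll.comp ha)
  have h2 : ωScottContinuous (fun x => Layer.arg2 (unroll (a x))) :=
    Layer.cont_arg2.comp (cont_unroll.comp ha)
  have := Layer.cont_cases (cont_unroll.comp ha)
    (fun t x => match t with
      | .pair _ _ => g x (Layer.arg1 (unroll (a x))) (Layer.arg2 (unroll (a x)))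
      | _ => (⊥ : D))
    (by
      intro t
      cases t <;> first
        | exact ωScottContinuous.const
        | exact hg.comp (Prod.ωScottContinuous.prodMk ωScottContinuous.fun_id
            (Prod.ωScottContinuous.prodMk h1 h2)))
    (fun _ => rfl) (by intro t x y f; cases t <;> rfl)
  convert this using 1
  funext x
  rw [casePair, Function.comp]
  cases unroll (a x) <;> rfl

theorem cont_caseAmb {g : α → D → D → D} (ha : ωScottContinuous a)
    (hg : ωScottContinuous (fun p : α × D × D => g p.1 p.2.1 p.2.2)) :
    ωScottContinuous (fun x => caseAmb (a x) (g x)) := by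
  have h1 : ωScottContinuous (fun x => Layer.arg1 (unroll (a x))) :=
    Layer.cont_arg1.comp (cont_unroll.comp ha)
  have h2 : ωScottContinuous (fun x => Layer.arg2 (unroll (a x))) :=
    Layer.cont_arg2.comp (cont_unroll.comp ha)
  have := Layer.cont_cases (cont_unroll.comp ha)
    (fun t x => match t with
      | .amb _ _ => g x (Layer.arg1 (unroll (a x))) (Layer.arg2 (unroll (a x)))
      | _ => (⊥ : D))
    (by
      intro t
      cases t <;> first
        | exact ωScottContinuous.const
        | exact hg.comp (Prod.ωScottContinuous.prodMk ωScottContinuous.fun_id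
            (Prod.ωScottContinuous.prodMk h1 h2)))
    (fun _ => rfl) (by intro t x y f; cases t <;> rfl)
  convert this using 1
  funext x
  rw [caseAmb, Function.comp]
  cases unroll (a x) <;> rfl

theorem cont_extend {n : ℕ} {e : α → Fin n → D} (ha : ωScottContinuous a)
    (he : ωScottContinuous e) : ωScottContinuous (fun x => extend (a x) (e x)) := by
  refine ωScottContinuous.of_apply₂ fun i => ?_
  refine Fin.cases ?_ (fun j => ?_) i
  · exact ha
  · exact he.apply₂ j

end

theorem cont_curry {α : Type} [OmegaCompletePartialOrder α] {F : α → D → D}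
    (hF : ωScottContinuous (fun p : α × D => F p.1 p.2)) (hd : ∀ x, ωScottContinuous (F x)) :
    ωScottContinuous (fun x => ContinuousHom.ofFun (F x) (hd x)) := by
  have h1 : ∀ d, ωScottContinuous (fun x => F x d) := fun d =>
    hF.comp (Prod.ωScottContinuous.prodMk ωScottContinuous.fun_id ωScottContinuous.const)
  refine Layer.cont_of_le (fun x y h d => (h1 d).monotone h) fun c z hz d => ?_
  change F (ωSup c) d ≤ z d
  rw [(h1 d).map_ωSup]
  exact ωSup_le _ _ fun i => hz i d

end D

/-- The continuous function `d ↦ F (η[a ↦ d])`. -/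
noncomputable def bind₁ {n : ℕ} (F : (Fin (n + 1) → D) →𝒄 D) (η : Fin n → D) : D →𝒄 D :=
  ContinuousHom.ofFun (fun d => F (extend d η))
    (F.ωScottContinuous.comp (D.cont_extend ωScottContinuous.fun_id ωScottContinuous.const))

theorem cont_bind₁_uncurried {n : ℕ} (F : (Fin (n + 1) → D) →𝒄 D) :
    ωScottContinuous (fun p : (Fin n → D) × D => F (extend p.2 p.1)) :=
  F.ωScottContinuous.comp
    (D.cont_extend Prod.ωScottContinuous_snd Prod.ωScottContinuous_fst)

theorem cont_bind₂_uncurried {n : ℕ} (F : (Fin (n + 2) → D) →𝒄 D) :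
    ωScottContinuous
      (fun p : (Fin n → D) × D × D => F (extend p.2.2 (extend p.2.1 p.1))) :=
  F.ωScottContinuous.comp
    (D.cont_extend (Prod.ωScottContinuous_snd.comp Prod.ωScottContinuous_snd)
      (D.cont_extend (Prod.ωScottContinuous_fst.comp Prod.ωScottContinuous_snd)
        Prod.ωScottContinuous_fst))

theorem cont_bind₁ {n : ℕ} (F : (Fin (n + 1) → D) →𝒄 D) : ωScottContinuous (bind₁ F) :=
  D.cont_curry (cont_bind₁_uncurried F) _

/-- The denotation of a program, as a continuous function of the environment. -/
noncomputable def den : {n : ℕ} → Prog n → ((Fin n → D) →𝒄 D)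
  | _, .var i => .ofFun (fun η => η i) (ωScottContinuous.apply i)
  | _, .lam M => .ofFun (fun η => D.fn (bind₁ (den M) η)) (D.cont_fn (cont_bind₁ (den M)))
  | _, .app M N => .ofFun (fun η => D.app (den M η) (den N η))
      (D.cont_app (den M).ωScottContinuous (den N).ωScottContinuous)
  | _, .sapp M N => .ofFun (fun η => D.sapp (den M η) (den N η))
      (D.cont_sapp (den M).ωScottContinuous (den N).ωScottContinuous)
  | _, .fix M => .ofFun (fun η => D.fix (den M η)) (D.cont_fix (den M).ωScottContinuous)
  | _, .bot => .ofFun (fun _ => ⊥) ωScottContinuous.const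
  | _, .nil => .ofFun (fun _ => D.nil) ωScottContinuous.const
  | _, .left M => .ofFun (fun η => D.left (den M η)) (D.cont_left (den M).ωScottContinuous)
  | _, .right M => .ofFun (fun η => D.right (den M η)) (D.cont_right (den M).ωScottContinuous)
  | _, .pair M N => .ofFun (fun η => D.pair (den M η) (den N η))
      (D.cont_pair (den M).ωScottContinuous (den N).ωScottContinuous)
  | _, .amb M N => .ofFun (fun η => D.amb (den M η) (den N η))
      (D.cont_amb (den M).ωScottContinuous (den N).ωScottContinuous)
  | _, .caseLR M L R => .ofFun
      (fun η => D.caseLR (den M η) (fun d => den L (extend d η)) (fun d => den R (extend d η)))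
      (D.cont_caseLR (den M).ωScottContinuous (cont_bind₁_uncurried (den L))
        (cont_bind₁_uncurried (den R)))
  | _, .casePair M N => .ofFun
      (fun η => D.casePair (den M η) (fun d e => den N (extend e (extend d η))))
      (D.cont_casePair (den M).ωScottContinuous (cont_bind₂_uncurried (den N)))
  | _, .caseAmb M N => .ofFun
      (fun η => D.caseAmb (den M η) (fun d e => den N (extend e (extend d η))))
      (D.cont_caseAmb (den M).ωScottContinuous (cont_bind₂_uncurried (den N)))

/-- The denotation `⟦M⟧` of a closed program. -/
noncomputable def val (M : Prog 0) : D := den M Fin.elim0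

/-! ## The choices `data(a)` -/

/-- The right-hand side of the coinductive definition of `d ∈ data(a)`, with `R` in place of
`data`. -/
def DataClauses (R : D → D → Prop) (a d : D) : Prop :=
  (∃ a' b', a = D.amb a' b' ∧ a' ≠ ⊥ ∧ R a' d) ∨
  (∃ a' b', a = D.amb a' b' ∧ b' ≠ ⊥ ∧ R b' d) ∨
  (a = D.amb ⊥ ⊥ ∧ d = ⊥) ∨
  (a = D.nil ∧ d = D.nil) ∨
  (∃ a' d', a = D.left a' ∧ d = D.left d' ∧ R a' d') ∨
  (∃ a' d', a = D.right a' ∧ d = D.right d' ∧ R a' d') ∨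
  (∃ a₁ a₂ d₁ d₂, a = D.pair a₁ a₂ ∧ d = D.pair d₁ d₂ ∧ R a₁ d₁ ∧ R a₂ d₂) ∨
  (∃ f, a = D.fn f ∧ d = a) ∨
  (a = ⊥ ∧ d = ⊥)

theorem DataClauses.mono : Monotone DataClauses := by
  intro R S h a d hR
  have h' : ∀ x y, R x y → S x y := h
  unfold DataClauses at *
  rcases hR with ⟨a', b', e, n, r⟩ | ⟨a', b', e, n, r⟩ | r | r | ⟨a', d', e, e', r⟩ |
    ⟨a', d', e, e', r⟩ | ⟨a₁, a₂, d₁, d₂, e, e', r, s⟩ | r | r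
  · exact .inl ⟨a', b', e, n, h' _ _ r⟩
  · exact .inr (.inl ⟨a', b', e, n, h' _ _ r⟩)
  · exact .inr (.inr (.inl r))
  · exact .inr (.inr (.inr (.inl r)))
  · exact .inr (.inr (.inr (.inr (.inl ⟨a', d', e, e', h' _ _ r⟩))))
  · exact .inr (.inr (.inr (.inr (.inr (.inl ⟨a', d', e, e', h' _ _ r⟩)))))
  · exact .inr (.inr (.inr (.inr (.inr (.inr (.inl
      ⟨a₁, a₂, d₁, d₂, e, e', h' _ _ r, h' _ _ s⟩))))))
  · exact .inr (.inr (.inr (.inr (.inr (.inr (.inr (.inl r)))))))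
  · exact .inr (.inr (.inr (.inr (.inr (.inr (.inr (.inr r)))))))

/-- `data(a)`: the largest relation satisfying the clauses. -/
def data (a : D) : Set D :=
  {d | OrderHom.gfp (⟨DataClauses, DataClauses.mono⟩ : (D → D → Prop) →o (D → D → Prop)) a d}

/-! ## Operational semantics of closed programs -/

namespace Prog

/-- `M` begins with a constructor (including `Amb`). -/
inductive IsCon : Prog 0 → Prop
  | nil : IsCon nil
  | left (M : Prog 0) : IsCon (left M)
  | right (M : Prog 0) : IsCon (right M)
  | pair (M N : Prog 0) : IsCon (pair M N)
  | amb (M N : Prog 0) : IsCon (amb M N)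

/-- `M` is a λ-abstraction. -/
def IsLam (M : Prog 0) : Prop := ∃ N, M = lam N

/-- Weak head normal forms. -/
def Whnf (M : Prog 0) : Prop := IsCon M ∨ IsLam M

/-- `⊥`-like programs. -/
inductive BotLike : Prog 0 → Prop
  | bot : BotLike bot
  | app (M N : Prog 0) (h : IsCon M) : BotLike (app M N)
  | sapp (M N : Prog 0) (h : IsCon M) : BotLike (sapp M N)
  | caseLR (M : Prog 0) (L R : Prog 1) (h : Whnf M) (hl : ∀ P, M ≠ left P)
      (hr : ∀ P, M ≠ right P) : BotLike (caseLR M L R)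
  | casePair (M : Prog 0) (N : Prog 2) (h : Whnf M) (hp : ∀ P Q, M ≠ pair P Q) :
      BotLike (casePair M N)
  | caseAmb (M : Prog 0) (N : Prog 2) (h : Whnf M) (ha : ∀ P Q, M ≠ amb P Q) :
      BotLike (caseAmb M N)

/-- Leftmost-outermost reduction `M ⇝ M'`. -/
inductive Step : Prog 0 → Prog 0 → Prop
  | beta (M : Prog 1) (N : Prog 0) : Step (app (lam M) N) (inst M N)
  | app {M M' : Prog 0} (N : Prog 0) (h : Step M M') : Step (app M N) (app M' N)
  | sbeta (M : Prog 1) (N : Prog 0) (hN : Whnf N) : Step (sapp (lam M) N) (inst M N)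
  | sappL {M M' : Prog 0} (N : Prog 0) (hN : Whnf N) (h : Step M M') :
      Step (sapp M N) (sapp M' N)
  | sappR (M : Prog 0) {N N' : Prog 0} (h : Step N N') : Step (sapp M N) (sapp M N')
  | fix (M : Prog 0) : Step (fix M) (app M (fix M))
  | caseLeft (M : Prog 0) (L R : Prog 1) : Step (caseLR (left M) L R) (inst L M)
  | caseRight (M : Prog 0) (L R : Prog 1) : Step (caseLR (right M) L R) (inst R M)
  | casePair (P Q : Prog 0) (N : Prog 2) : Step (casePair (pair P Q) N) (inst₂ N P Q)
  | caseAmb (P Q : Prog 0) (N : Prog 2) : Step (caseAmb (amb P Q) N) (inst₂ N P Q)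
  | caseLRArg {M M' : Prog 0} (L R : Prog 1) (h : Step M M') :
      Step (caseLR M L R) (caseLR M' L R)
  | casePairArg {M M' : Prog 0} (N : Prog 2) (h : Step M M') :
      Step (casePair M N) (casePair M' N)
  | caseAmbArg {M M' : Prog 0} (N : Prog 2) (h : Step M M') :
      Step (caseAmb M N) (caseAmb M' N)
  | botLike (M : Prog 0) (h : BotLike M) : Step M bot

/-- The choice reduction (`c` over the arrow). -/
inductive CStep : Prog 0 → Prog 0 → Prop
  | step {M M' : Prog 0} (h : Step M M') : CStep M M'
  | ambL {M M' : Prog 0} (N : Prog 0) (h : Step M M') : CStep (amb M N) (amb M' N)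
  | ambR (M : Prog 0) {N N' : Prog 0} (h : Step N N') : CStep (amb M N) (amb M N')
  | chooseL (M N : Prog 0) (h : Whnf M) : CStep (amb M N) M
  | chooseR (M N : Prog 0) (h : Whnf N) : CStep (amb M N) N

/-- The parallel reduction (`p` over the arrow). -/
inductive PStep : Prog 0 → Prog 0 → Prop
  | choice {M M' : Prog 0} (h : CStep M M') : PStep M M'
  | nil : PStep nil nil
  | left {M M' : Prog 0} (h : PStep M M') : PStep (left M) (left M')
  | right {M M' : Prog 0} (h : PStep M M') : PStep (right M) (right M')
  | pair {M M' N N' : Prog 0} (h : PStep M M') (k : PStep N N') : PStep (pair M N) (pair M' N')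
  | lam (M : Prog 1) : PStep (lam M) (lam M)

/-- Unfair infinite reduction sequences: in some `Amb` (below data constructors), from some point
on, only one side is ever reduced. -/
inductive Unfair : (ℕ → Prog 0) → Prop
  | ambL (M L : ℕ → Prog 0) (R : Prog 0) (hM : ∀ i, M i = amb (L i) R)
      (h : ∀ i, Step (L i) (L (i + 1))) : Unfair M
  | ambR (M R : ℕ → Prog 0) (L : Prog 0) (hM : ∀ i, M i = amb L (R i))
      (h : ∀ i, Step (R i) (R (i + 1))) : Unfair M
  | left (M N : ℕ → Prog 0) (hM : ∀ i, M i = left (N i)) (h : Unfair N) : Unfair M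
  | right (M N : ℕ → Prog 0) (hM : ∀ i, M i = right (N i)) (h : Unfair N) : Unfair M
  | pairL (M N K : ℕ → Prog 0) (hM : ∀ i, M i = pair (N i) (K i)) (h : Unfair N) : Unfair M
  | pairR (M N K : ℕ → Prog 0) (hM : ∀ i, M i = pair (N i) (K i)) (h : Unfair K) : Unfair M
  | tail (M : ℕ → Prog 0) (h : Unfair (fun i => M (i + 1))) : Unfair M

/-- A computation of `P`: an infinite fair reduction sequence starting with `P`. -/
structure IsComputation (P : Prog 0) (M : ℕ → Prog 0) : Prop where
  start : M 0 = P
  step : ∀ i, PStep (M i) (M (i + 1))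
  fair : ¬ Unfair M

/-- The fully evaluated part `M_D` of a program (for open programs: in an environment). -/
noncomputable def evalPart : {n : ℕ} → Prog n → (Fin n → D) → D
  | _, nil, _ => D.nil
  | _, left M, η => D.left (evalPart M η)
  | _, right M, η => D.right (evalPart M η)
  | _, pair M N, η => D.pair (evalPart M η) (evalPart N η)
  | _, lam M, η => den (lam M) η
  | _, _, _ => ⊥

/-- `M_D` for a closed program `M`. -/
noncomputable def toD (M : Prog 0) : D := evalPart M Fin.elim0

end Prog

/-! ## Substitution -/

namespace Prog

/-! The argument is coinductive. Say that `Computes a d` holds when `a` is the denotation of some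
closed program having a computation whose evaluated parts have supremum `d`. Since `data` is a
greatest fixed point, it suffices that `Computes` is consistent with its clauses
(`computes_le_dataClauses`). Monotonicity of the evaluated parts is separate and easy: a program
that makes a choice step has evaluated part ⊥, and the remaining parallel steps act under data
constructors or do nothing.

For consistency, follow a computation up to its first weak head normal form. Until then every
parallel step is a `Step`, which preserves denotations. If the normal form begins with a data
constructor, that constructor never changes again, each component runs through a fair computation of
its own, and continuity of the constructor moves the supremum inside. A λ-abstraction stays fixed.

At an `Amb`, suppose first that a side is eventually chosen. It is then a weak head normal form, so
it does not denote ⊥, and the rest of the sequence is a computation of that side. Suppose instead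
that no choice is ever made. If one side denoted other than ⊥, it could reduce only finitely often,
so from some point on only the other side would be reduced, which is unfair. Hence both sides denote
⊥ and the clause for Amb(⊥,⊥) applies. If no weak head normal form is ever reached, the program
reduces forever, and it must denote ⊥.

The last two cases need a real theorem: a closed program that does not denote ⊥ has no infinite
reduction (`acc_of_val_ne_bot`). It combines two facts. First, such a program evaluates to a weak
head normal form (`exists_evals`), by a logical relation between `D` and programs that is built
along the finite approximations and then passed to the limit. Second, reduction is deterministic on
such programs (`Step.unique`), so one terminating reduction sequence excludes every infinite one. -/

theorem extend_comp {α β : Type} {n : ℕ} (f : α → β) (x : α) (η : Fin n → α) :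
    (fun i => f (extend x η i)) = extend (f x) (fun i => f (η i)) := by
  funext i
  refine Fin.cases ?_ (fun j => ?_) i <;> rfl

theorem extend_extend_succ {α : Type} {n m : ℕ} (ρ : Fin n → Fin m) (x : α) (η : Fin m → α) :
    (fun i => extend x η (extend 0 (Fin.succ ∘ ρ) i)) = extend x (fun i => η (ρ i)) := by
  funext i
  refine Fin.cases ?_ (fun j => ?_) i <;> rfl

theorem lift_rename {n m k : ℕ} (ρ : Fin n → Fin m) (σ : Fin m → Prog k) :
    (fun i => lift σ (extend 0 (Fin.succ ∘ ρ) i)) = lift (fun i => σ (ρ i)) :=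
  extend_extend_succ ρ _ _

theorem lift_var {n : ℕ} : lift (var : Fin n → Prog n) = var := by
  funext i
  refine Fin.cases ?_ (fun j => ?_) i <;> rfl

theorem subst_var {n : ℕ} (M : Prog n) : subst var M = M := by
  induction M <;> simp_all [subst, lift_var]

/-- Substitution under a binder weakens by renaming. Composition laws involving renamings are
therefore needed before substitutions can be composed in `subst_subst`. -/
theorem subst_rename {n m k : ℕ} (ρ : Fin n → Fin m) (σ : Fin m → Prog k) (M : Prog n) :
    subst σ (rename ρ M) = subst (fun i => σ (ρ i)) M := by
  induction M generalizing m k <;> simp_all [subst, rename, lift_rename]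

theorem rename_rename {n m k : ℕ} (ρ : Fin n → Fin m) (τ : Fin m → Fin k) (M : Prog n) :
    rename τ (rename ρ M) = rename (τ ∘ ρ) M := by
  have h : ∀ {n m k : ℕ} (ρ : Fin n → Fin m) (τ : Fin m → Fin k),
      (extend 0 (Fin.succ ∘ τ)) ∘ (extend 0 (Fin.succ ∘ ρ)) =
        (extend 0 (Fin.succ ∘ (τ ∘ ρ)) : Fin (n + 1) → Fin (k + 1)) :=
    fun ρ τ => extend_extend_succ ρ _ _
  induction M generalizing m k <;> simp only [rename, Function.comp_apply, *]

theorem rename_lift {n m k : ℕ} (σ : Fin n → Prog m) (ρ : Fin m → Fin k) :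
    (fun i => rename (extend 0 (Fin.succ ∘ ρ)) (lift σ i)) = lift (fun i => rename ρ (σ i)) := by
  funext i
  refine Fin.cases ?_ (fun j => ?_) i
  · rfl
  · change rename _ (rename _ (σ j)) = rename _ (rename _ (σ j))
    rw [rename_rename, rename_rename]; rfl

theorem rename_subst {n m k : ℕ} (σ : Fin n → Prog m) (ρ : Fin m → Fin k) (M : Prog n) :
    rename ρ (subst σ M) = subst (fun i => rename ρ (σ i)) M := by
  induction M generalizing m k <;> simp_all [subst, rename, rename_lift]

theorem subst_lift {n m k : ℕ} (σ : Fin n → Prog m) (τ : Fin m → Prog k) :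
    (fun i => subst (lift τ) (lift σ i)) = lift (fun i => subst τ (σ i)) := by
  funext i
  refine Fin.cases ?_ (fun j => ?_) i
  · rfl
  · change subst _ (rename _ (σ j)) = rename _ (subst _ (σ j))
    rw [subst_rename, rename_subst]; rfl

theorem subst_subst {n m k : ℕ} (σ : Fin n → Prog m) (τ : Fin m → Prog k) (M : Prog n) :
    subst τ (subst σ M) = subst (fun i => subst τ (σ i)) M := by
  induction M generalizing m k <;> simp_all [subst, subst_lift]

/-- The weakening done by `lift` is undone by instantiating the fresh variable. In the fundamental
lemma this turns a reduct under a substitution into one simultaneous substitution, to which the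
induction hypothesis applies. -/
theorem inst_subst_lift {n m : ℕ} (σ : Fin n → Prog m) (M : Prog (n + 1)) (P : Prog m) :
    inst (subst (lift σ) M) P = subst (extend P σ) M := by
  rw [inst, subst_subst]
  congr 1
  funext i
  refine Fin.cases rfl (fun j => ?_) i
  change subst _ (rename _ (σ j)) = σ j
  rw [subst_rename]
  exact subst_var _

theorem inst₂_subst_lift {n m : ℕ} (σ : Fin n → Prog m) (M : Prog (n + 2)) (P Q : Prog m) :
    inst₂ (subst (lift (lift σ)) M) P Q = subst (extend Q (extend P σ)) M := by
  rw [inst₂, subst_subst]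
  congr 1
  funext i
  refine Fin.cases rfl (fun j => ?_) i
  change subst _ (rename _ (lift σ j)) = _
  rw [subst_rename]
  refine Fin.cases rfl (fun j => ?_) j
  change subst _ (rename _ (σ j)) = σ j
  rw [subst_rename]
  exact subst_var _

/-! ### Substitution and denotations -/

theorem den_rename {n m : ℕ} (ρ : Fin n → Fin m) (M : Prog n) (η : Fin m → D) :
    den (rename ρ M) η = den M (fun i => η (ρ i)) := by
  induction M generalizing m with
  | lam M ih =>
    change D.fn _ = D.fn _
    congr 1
    ext d
    exact (ih _ _).trans (by rw [extend_extend_succ]; rfl)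
  | caseLR M L R ihM ihL ihR =>
    change D.caseLR (den _ _) _ _ = D.caseLR (den _ _) _ _
    simp only [ihM, ihL, ihR, extend_extend_succ]
  | casePair M N ihM ihN =>
    change D.casePair (den _ _) _ = D.casePair (den _ _) _
    simp only [ihM, ihN, extend_extend_succ]
  | caseAmb M N ihM ihN =>
    change D.caseAmb (den _ _) _ = D.caseAmb (den _ _) _
    simp only [ihM, ihN, extend_extend_succ]
  | var i => rfl
  | bot => rfl
  | nil => rfl
  | app M N ihM ihN => exact congrArg₂ D.app (ihM _ _) (ihN _ _)
  | sapp M N ihM ihN => exact congrArg₂ D.sapp (ihM _ _) (ihN _ _)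
  | pair M N ihM ihN => exact congrArg₂ D.pair (ihM _ _) (ihN _ _)
  | amb M N ihM ihN => exact congrArg₂ D.amb (ihM _ _) (ihN _ _)
  | fix M ihM => exact congrArg D.fix (ihM _ _)
  | left M ihM => exact congrArg D.left (ihM _ _)
  | right M ihM => exact congrArg D.right (ihM _ _)

theorem den_lift {n m : ℕ} (σ : Fin n → Prog m) (d : D) (η : Fin m → D) :
    (fun i => den (lift σ i) (extend d η)) = extend d (fun i => den (σ i) η) := by
  funext i
  refine Fin.cases rfl (fun j => ?_) i
  exact den_rename _ _ _

/-- Denotations are compositional, and under a binder the lifted substitution corresponds to the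
extended environment (`den_lift`). The cases below merely spell this out. -/
theorem den_subst {n m : ℕ} (σ : Fin n → Prog m) (M : Prog n) (η : Fin m → D) :
    den (subst σ M) η = den M (fun i => den (σ i) η) := by
  induction M generalizing m with
  | lam M ih =>
    change D.fn _ = D.fn _
    congr 1
    ext d
    exact (ih _ _).trans (by rw [den_lift]; rfl)
  | caseLR M L R ihM ihL ihR =>
    change D.caseLR (den _ _) _ _ = D.caseLR (den _ _) _ _
    simp only [ihM, ihL, ihR, den_lift]
  | casePair M N ihM ihN =>
    change D.casePair (den _ _) _ = D.casePair (den _ _) _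
    simp only [ihM, ihN, den_lift]
  | caseAmb M N ihM ihN =>
    change D.caseAmb (den _ _) _ = D.caseAmb (den _ _) _
    simp only [ihM, ihN, den_lift]
  | var i => rfl
  | bot => rfl
  | nil => rfl
  | app M N ihM ihN => exact congrArg₂ D.app (ihM _ _) (ihN _ _)
  | sapp M N ihM ihN => exact congrArg₂ D.sapp (ihM _ _) (ihN _ _)
  | pair M N ihM ihN => exact congrArg₂ D.pair (ihM _ _) (ihN _ _)
  | amb M N ihM ihN => exact congrArg₂ D.amb (ihM _ _) (ihN _ _)
  | fix M ihM => exact congrArg D.fix (ihM _ _)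
  | left M ihM => exact congrArg D.left (ihM _ _)
  | right M ihM => exact congrArg D.right (ihM _ _)

theorem val_inst (M : Prog 1) (N : Prog 0) :
    val (inst M N) = den M (extend (val N) Fin.elim0) := by
  rw [val, inst, den_subst, extend_comp (fun P => den P Fin.elim0)]
  rfl

theorem val_inst₂ (M : Prog 2) (P Q : Prog 0) :
    val (inst₂ M P Q) = den M (extend (val Q) (extend (val P) Fin.elim0)) := by
  rw [val, inst₂, den_subst, extend_comp (fun P => den P Fin.elim0),
    extend_comp (fun P => den P Fin.elim0)]
  rfl

end Prog

/-! ## Reduction preserves denotations -/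

namespace D

theorem roll_eq_bot {s : Layer D} : roll s = ⊥ ↔ s = Layer.bot := by
  rw [← unroll_eq_bot, unroll_roll]

theorem app_fn (f : D →𝒄 D) (d : D) : app (fn f) d = f d := by
  rw [app, fn, unroll_roll]

theorem app_roll (s : Layer D) (d : D) : app (roll s) d = Layer.fnPart s d := by
  rw [app, unroll_roll]
  cases s <;> rfl

theorem caseLR_roll (s : Layer D) (l r : D → D) : caseLR (roll s) l r =
    match s with
    | .left d => l d
    | .right d => r d
    | _ => ⊥ := by
  cases s <;> rw [caseLR, unroll_roll]

theorem casePair_roll (s : Layer D) (g : D → D → D) : casePair (roll s) g =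
    match s with
    | .pair d e => g d e
    | _ => ⊥ := by
  cases s <;> rw [casePair, unroll_roll]

theorem caseAmb_roll (s : Layer D) (g : D → D → D) : caseAmb (roll s) g =
    match s with
    | .amb d e => g d e
    | _ => ⊥ := by
  cases s <;> rw [caseAmb, unroll_roll]

theorem app_bot (d : D) : app ⊥ d = ⊥ := by
  rw [app, unroll_eq_bot.2 rfl]

theorem sapp_bot (d : D) : sapp ⊥ d = ⊥ := by
  rw [sapp, app_bot, ite_self]

theorem sapp_of_ne {a d : D} (h : d ≠ ⊥) : sapp a d = app a d := if_neg h

theorem caseLR_bot (l r : D → D) : caseLR ⊥ l r = ⊥ := by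
  rw [caseLR, unroll_eq_bot.2 rfl]

theorem casePair_bot (g : D → D → D) : casePair ⊥ g = ⊥ := by
  rw [casePair, unroll_eq_bot.2 rfl]

theorem caseAmb_bot (g : D → D → D) : caseAmb ⊥ g = ⊥ := by
  rw [caseAmb, unroll_eq_bot.2 rfl]

/-- For a function this is the fixed point equation; otherwise both sides are ⊥. It makes unfolding
of `rec` sound without a case distinction. -/
theorem fix_eq_app (a : D) : fix a = app a (fix a) := by
  unfold fix app
  cases unroll a <;> first | rfl | exact (lfp_isLeast _).1.symm

end D

namespace Prog

theorem val_caseLR (M : Prog 0) (L R : Prog 1) : val (caseLR M L R) =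
    D.caseLR (val M) (fun d => den L (extend d Fin.elim0)) (fun d => den R (extend d Fin.elim0)) :=
  rfl

theorem val_casePair (M : Prog 0) (N : Prog 2) : val (casePair M N) =
    D.casePair (val M) (fun d e => den N (extend e (extend d Fin.elim0))) := rfl

theorem val_caseAmb (M : Prog 0) (N : Prog 2) : val (caseAmb M N) =
    D.caseAmb (val M) (fun d e => den N (extend e (extend d Fin.elim0))) := rfl

theorem Whnf.val_ne_bot {M : Prog 0} (h : Whnf M) : val M ≠ ⊥ := by
  rcases h with h | ⟨N, rfl⟩
  · cases h <;> exact fun e => by cases D.roll_eq_bot.1 e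
  · exact fun e => by cases D.roll_eq_bot.1 e

theorem IsCon.app_val {M : Prog 0} (h : IsCon M) (d : D) : D.app (val M) d = ⊥ := by
  cases h <;> exact D.app_roll _ d

/-- The operation at the root meets a value of the wrong shape, where its denotation defaults to ⊥.
-/
theorem BotLike.val_eq {M : Prog 0} (h : BotLike M) : val M = ⊥ := by
  cases h with
  | bot => rfl
  | app M N h => exact h.app_val _
  | sapp M N h =>
    change D.sapp (val M) _ = ⊥
    rw [D.sapp, h.app_val, ite_self]
  | caseLR M L R h hl hr =>
    rcases h with h | ⟨N, rfl⟩
    · cases h <;> first | exact absurd rfl (hl _) | exact absurd rfl (hr _) | exact D.caseLR_roll _ _ _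
    · exact D.caseLR_roll _ _ _
  | casePair M N h hp =>
    rcases h with h | ⟨N, rfl⟩
    · cases h <;> first | exact absurd rfl (hp _ _) | exact D.casePair_roll _ _
    · exact D.casePair_roll _ _
  | caseAmb M N h ha =>
    rcases h with h | ⟨N, rfl⟩
    · cases h <;> first | exact absurd rfl (ha _ _) | exact D.caseAmb_roll _ _
    · exact D.caseAmb_roll _ _

theorem Step.val_eq {M M' : Prog 0} (h : Step M M') : val M = val M' := by
  induction h with
  | beta M N => exact (D.app_fn _ _).trans (val_inst M N).symm
  | app N h ih => exact congrArg (D.app · (val N)) ih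
  | sbeta M N hN =>
    -- A weak head normal form does not denote ⊥, so strict and ordinary application agree on it.
    exact (D.sapp_of_ne hN.val_ne_bot).trans ((D.app_fn _ _).trans (val_inst M N).symm)
  | sappL N hN h ih => exact congrArg (D.sapp · (val N)) ih
  | sappR M h ih => exact congrArg (D.sapp (val M)) ih
  | fix M => exact D.fix_eq_app _
  | caseLeft M L R => exact (D.caseLR_roll _ _ _).trans (val_inst L M).symm
  | caseRight M L R => exact (D.caseLR_roll _ _ _).trans (val_inst R M).symm
  | casePair P Q N => exact (D.casePair_roll _ _).trans (val_inst₂ N P Q).symm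
  | caseAmb P Q N => exact (D.caseAmb_roll _ _).trans (val_inst₂ N P Q).symm
  | caseLRArg L R h ih => rw [val_caseLR, val_caseLR, ih]
  | casePairArg N h ih => rw [val_casePair, val_casePair, ih]
  | caseAmbArg N h ih => rw [val_caseAmb, val_caseAmb, ih]
  | botLike M h => exact h.val_eq

/-! ### Determinism and evaluation to weak head normal form -/

theorem Whnf.not_step {M M' : Prog 0} (h : Whnf M) : ¬ Step M M' := by
  intro hs
  rcases h with h | ⟨N, rfl⟩
  · cases h <;> (cases hs; rename_i h; cases h)
  · cases hs; rename_i h; cases h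

theorem IsCon.not_step {M M' : Prog 0} (h : IsCon M) : ¬ Step M M' := Whnf.not_step (.inl h)

theorem not_step_lam {M : Prog 1} {M' : Prog 0} : ¬ Step (lam M) M' := Whnf.not_step (.inr ⟨M, rfl⟩)

/-- Reduction is deterministic on programs that do not denote `⊥`. -/
theorem Step.unique {M M₁ M₂ : Prog 0} (h₁ : Step M M₁) (h₂ : Step M M₂) (hM : val M ≠ ⊥) :
    M₁ = M₂ := by
  -- The hypothesis on the denotation is essential: a constructor term strictly applied to a
  -- reducible argument may reduce to ⊥ or reduce its argument. Such overlaps occur only at ⊥-like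
  -- programs.
  have hb : ¬ BotLike M := fun h => hM h.val_eq
  induction h₁ generalizing M₂ with
  | beta M N =>
    cases h₂ with
    | beta => rfl
    | app _ h => exact absurd h not_step_lam
    | botLike _ h => exact absurd h hb
  | app N h ih =>
    cases h₂ with
    | beta => exact absurd h not_step_lam
    | app _ h' =>
      -- Evaluation contexts are strict in the position being reduced, so the subterm does not
      -- denote ⊥ either and the induction hypothesis applies. The other context rules repeat this.
      have hv : val _ ≠ ⊥ := fun e => hM ((congrArg (D.app · (val N)) e).trans (D.app_bot _))
      rw [ih h' hv fun h => hv h.val_eq]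
    | botLike _ h => exact absurd h hb
  | sbeta M N hN =>
    cases h₂ with
    | sbeta => rfl
    | sappL _ _ h => exact absurd h not_step_lam
    | sappR _ h => exact absurd h hN.not_step
    | botLike _ h => exact absurd h hb
  | sappL N hN h ih =>
    cases h₂ with
    | sbeta => exact absurd h not_step_lam
    | sappL _ _ h' =>
      have hv : val _ ≠ ⊥ := fun e => hM ((congrArg (D.sapp · (val N)) e).trans (D.sapp_bot _))
      rw [ih h' hv fun h => hv h.val_eq]
    | sappR _ h => exact absurd h hN.not_step
    | botLike _ h => exact absurd h hb
  | sappR M h ih =>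
    cases h₂ with
    | sbeta _ _ hN => exact absurd h hN.not_step
    | sappL _ hN => exact absurd h hN.not_step
    | sappR _ h' =>
      have hv : val _ ≠ ⊥ := fun e => hM ((congrArg (D.sapp (val M)) e).trans (if_pos rfl))
      rw [ih h' hv fun h => hv h.val_eq]
    | botLike _ h => exact absurd h hb
  | fix M =>
    cases h₂ with
    | fix => rfl
    | botLike _ h => exact absurd h hb
  | caseLeft M L R =>
    cases h₂ with
    | caseLeft => rfl
    | caseLRArg _ _ h => exact absurd h (IsCon.left _).not_step
    | botLike _ h => exact absurd h hb
  | caseRight M L R =>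
    cases h₂ with
    | caseRight => rfl
    | caseLRArg _ _ h => exact absurd h (IsCon.right _).not_step
    | botLike _ h => exact absurd h hb
  | casePair P Q N =>
    cases h₂ with
    | casePair => rfl
    | casePairArg _ h => exact absurd h (IsCon.pair _ _).not_step
    | botLike _ h => exact absurd h hb
  | caseAmb P Q N =>
    cases h₂ with
    | caseAmb => rfl
    | caseAmbArg _ h => exact absurd h (IsCon.amb _ _).not_step
    | botLike _ h => exact absurd h hb
  | caseLRArg L R h ih =>
    cases h₂ with
    | caseLeft => exact absurd h (IsCon.left _).not_step
    | caseRight => exact absurd h (IsCon.right _).not_step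
    | caseLRArg _ _ h' =>
      have hv : val _ ≠ ⊥ := fun e => hM (by rw [val_caseLR, e, D.caseLR_bot])
      rw [ih h' hv fun h => hv h.val_eq]
    | botLike _ h => exact absurd h hb
  | casePairArg N h ih =>
    cases h₂ with
    | casePair => exact absurd h (IsCon.pair _ _).not_step
    | casePairArg _ h' =>
      have hv : val _ ≠ ⊥ := fun e => hM (by rw [val_casePair, e, D.casePair_bot])
      rw [ih h' hv fun h => hv h.val_eq]
    | botLike _ h => exact absurd h hb
  | caseAmbArg N h ih =>
    cases h₂ with
    | caseAmb => exact absurd h (IsCon.amb _ _).not_step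
    | caseAmbArg _ h' =>
      have hv : val _ ≠ ⊥ := fun e => hM (by rw [val_caseAmb, e, D.caseAmb_bot])
      rw [ih h' hv fun h => hv h.val_eq]
    | botLike _ h => exact absurd h hb
  | botLike M h => exact absurd h hb

/-- `M` evaluates to the weak head normal form `V`. -/
def Evals (M V : Prog 0) : Prop := Relation.ReflTransGen Step M V ∧ Whnf V

theorem Evals.of_whnf {V : Prog 0} (h : Whnf V) : Evals V V := ⟨.refl, h⟩

theorem val_eq_of_steps {M V : Prog 0} (h : Relation.ReflTransGen Step M V) : val M = val V := by
  induction h with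
  | refl => rfl
  | tail _ h ih => exact ih.trans h.val_eq

theorem Evals.val_ne_bot {M V : Prog 0} (h : Evals M V) : val M ≠ ⊥ :=
  val_eq_of_steps h.1 ▸ h.2.val_ne_bot

theorem Evals.of_steps {M M' V : Prog 0} (h : Relation.ReflTransGen Step M M') (h' : Evals M' V) :
    Evals M V :=
  ⟨h.trans h'.1, h'.2⟩

/-- A program with a weak head normal form does not denote ⊥, so its reduction is deterministic and
any step lies on the path to `V`. -/
theorem Evals.of_step {M M' V : Prog 0} (h : Evals M V) (hs : Step M M') : Evals M' V := by
  obtain ⟨h1, h2⟩ := h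
  rcases Relation.ReflTransGen.cases_head h1 with rfl | ⟨M'', h3, h4⟩
  · exact absurd hs h2.not_step
  · have hM : val M ≠ ⊥ := Evals.val_ne_bot ⟨h1, h2⟩
    rw [h3.unique hs hM] at h4
    exact ⟨h4, h2⟩

theorem Evals.unique {M V W : Prog 0} (h : Evals M V) (h' : Evals M W) : V = W := by
  obtain ⟨h1, h2⟩ := h
  induction h1 using Relation.ReflTransGen.head_induction_on with
  | refl =>
    rcases Relation.ReflTransGen.cases_head h'.1 with e | ⟨M'', h3, -⟩
    · exact e
    · exact absurd h3 h2.not_step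
  | head hs _ ih => exact ih (h'.of_step hs)

/-- Every program on the path to `V` has only the next one as a reduct, and `V` has none;
accessibility is carried backwards along the path. -/
theorem Evals.acc {M V : Prog 0} (h : Evals M V) : Acc (flip Step) M := by
  obtain ⟨h1, h2⟩ := h
  induction h1 using Relation.ReflTransGen.head_induction_on with
  | refl => exact ⟨_, fun _ hs => absurd hs h2.not_step⟩
  | head hs hr ih =>
    refine ⟨_, fun _ hs' => ?_⟩
    rw [hs'.unique hs (Evals.val_ne_bot ⟨.head hs hr, h2⟩)]
    exact ih

end Prog

/-! ## The logical relation between denotations and closed programs -/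

namespace Layer

open Prog

/-- A relation between `X` and closed programs, lifted to `Layer X`: a non-bottom layer is related
to the programs that evaluate to the same constructor with related components. -/
def Lifted {X : Type} [OmegaCompletePartialOrder X] (R : X → Prog 0 → Prop) :
    Layer X → Prog 0 → Prop
  | bot, _ => True
  | nil, P => Evals P Prog.nil
  | left x, P => ∃ M, Evals P (Prog.left M) ∧ R x M
  | right x, P => ∃ M, Evals P (Prog.right M) ∧ R x M
  | pair x y, P => ∃ M N, Evals P (Prog.pair M N) ∧ R x M ∧ R y N
  | amb x y, P => ∃ M N, Evals P (Prog.amb M N) ∧ R x M ∧ R y N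
  | fn f, P => ∃ M, Evals P (Prog.lam M) ∧ ∀ y Q, R y Q → R (f y) (inst M Q)

section
variable {X Y : Type} [OmegaCompletePartialOrder X] [OmegaCompletePartialOrder Y]
  {R : X → Prog 0 → Prop} {S : Y → Prog 0 → Prop} {s : Layer X} {P Q : Prog 0}

/-- Only the result of evaluation enters the lifted relation, so it is closed under reduction taken
backwards. This is what lets related values be transported to the unreduced program. -/
theorem Lifted.of_steps (h : Lifted R s Q) (hs : Relation.ReflTransGen Step P Q) :
    Lifted R s P := by
  cases s
  · trivial
  · exact Evals.of_steps hs h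
  · obtain ⟨M, h1, h2⟩ := h
    exact ⟨M, h1.of_steps hs, h2⟩
  · obtain ⟨M, h1, h2⟩ := h
    exact ⟨M, h1.of_steps hs, h2⟩
  · obtain ⟨M, N, h1, h2⟩ := h
    exact ⟨M, N, h1.of_steps hs, h2⟩
  · obtain ⟨M, N, h1, h2⟩ := h
    exact ⟨M, N, h1.of_steps hs, h2⟩
  · obtain ⟨M, h1, h2⟩ := h
    exact ⟨M, h1.of_steps hs, h2⟩

/-- That the value itself stays related matters for strict application, which substitutes the
evaluated argument. -/
theorem Lifted.exists_evals (h : Lifted R s P) (hs : s ≠ bot) : ∃ V, Evals P V ∧ Lifted R s V := by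
  cases s
  · exact absurd rfl hs
  · exact ⟨_, h, .of_whnf h.2⟩
  · obtain ⟨M, h1, h2⟩ := h
    exact ⟨_, h1, M, .of_whnf h1.2, h2⟩
  · obtain ⟨M, h1, h2⟩ := h
    exact ⟨_, h1, M, .of_whnf h1.2, h2⟩
  · obtain ⟨M, N, h1, h2⟩ := h
    exact ⟨_, h1, M, N, .of_whnf h1.2, h2⟩
  · obtain ⟨M, N, h1, h2⟩ := h
    exact ⟨_, h1, M, N, .of_whnf h1.2, h2⟩
  · obtain ⟨M, h1, h2⟩ := h
    exact ⟨_, h1, M, .of_whnf h1.2, h2⟩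

/-- Both directions are required because of the function summand: an argument over `Y` is sent to
`X` by `p` before the function is applied. -/
theorem Lifted.map {e : X →𝒄 Y} {p : Y →𝒄 X} (he : ∀ x M, R x M → S (e x) M)
    (hp : ∀ y M, S y M → R (p y) M) (h : Lifted R s P) : Lifted S (map e p s) P := by
  cases s
  · trivial
  · exact h
  · obtain ⟨M, h1, h2⟩ := h
    exact ⟨M, h1, he _ _ h2⟩
  · obtain ⟨M, h1, h2⟩ := h
    exact ⟨M, h1, he _ _ h2⟩
  · obtain ⟨M, N, h1, h2, h3⟩ := h
    exact ⟨M, N, h1, he _ _ h2, he _ _ h3⟩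
  · obtain ⟨M, N, h1, h2, h3⟩ := h
    exact ⟨M, N, h1, he _ _ h2, he _ _ h3⟩
  · obtain ⟨M, h1, h2⟩ := h
    exact ⟨M, h1, fun y Q hQ => he _ _ (h2 _ _ (hp _ _ hQ))⟩

/-- The lifting of a relation that is closed under suprema of chains is closed under suprema of
chains. -/
theorem Lifted.sup [OrderBot X] (hbot : ∀ M, R ⊥ M)
    (hsup : ∀ (c : Chain X) M, (∀ i, R (c i) M) → R (ωSup c) M) (c : Chain (Layer X))
    (h : ∀ i, Lifted R (c i) P) : Lifted R (ωSup c) P := by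
  by_cases hc : ∃ n, c n ≠ bot
  · obtain ⟨n, hn⟩ := hc
    rw [sup_eq c n hn]
    -- All non-bottom members of the chain share the constructor of `c n`, so one case distinction
    -- on `c n` settles the shape of every member.
    have hle : ∀ i, c i = bot ∨ (∃ x y f, c i = refill (c n) x y f) := by
      intro i
      by_cases hi : c i = bot
      · exact .inl hi
      · refine .inr ⟨arg1 (c i), arg2 (c i), fnPart (c i), ?_⟩
        conv_lhs => rw [← refill_self (c i)]
        rcases le_total i n with hl | hl
        · exact refill_congr (OrderHomClass.mono c hl) hi _ _ _
        · exact (refill_congr (OrderHomClass.mono c hl) hn _ _ _).symm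
    have hP := h n
    generalize c n = t at hle hn hP
    cases t
    · exact absurd rfl hn
    · exact hP
    · obtain ⟨M, h1, -⟩ := hP
      refine ⟨M, h1, hsup _ _ fun i => ?_⟩
      change R (arg1 (c i)) M
      have hi := h i
      rcases hle i with e | ⟨x, y, f, e⟩ <;> rw [e] at hi ⊢
      · exact hbot _
      · obtain ⟨M', h1', h2⟩ := hi
        -- Each member supplies its own witness. Uniqueness of the value of `P` identifies it with
        -- the witness of `c n`, so the components form a chain related to one program.
        cases h1.unique h1'
        exact h2
    · obtain ⟨M, h1, -⟩ := hP
      refine ⟨M, h1, hsup _ _ fun i => ?_⟩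
      change R (arg1 (c i)) M
      have hi := h i
      rcases hle i with e | ⟨x, y, f, e⟩ <;> rw [e] at hi ⊢
      · exact hbot _
      · obtain ⟨M', h1', h2⟩ := hi
        cases h1.unique h1'
        exact h2
    · obtain ⟨M, N, h1, -⟩ := hP
      refine ⟨M, N, h1, hsup _ _ fun i => ?_, hsup _ _ fun i => ?_⟩
      · change R (arg1 (c i)) M
        have hi := h i
        rcases hle i with e | ⟨x, y, f, e⟩ <;> rw [e] at hi ⊢
        · exact hbot _
        · obtain ⟨M', N', h1', h2⟩ := hi
          cases h1.unique h1'
          exact h2.1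
      · change R (arg2 (c i)) N
        have hi := h i
        rcases hle i with e | ⟨x, y, f, e⟩ <;> rw [e] at hi ⊢
        · exact hbot _
        · obtain ⟨M', N', h1', h2⟩ := hi
          cases h1.unique h1'
          exact h2.2
    · obtain ⟨M, N, h1, -⟩ := hP
      refine ⟨M, N, h1, hsup _ _ fun i => ?_, hsup _ _ fun i => ?_⟩
      · change R (arg1 (c i)) M
        have hi := h i
        rcases hle i with e | ⟨x, y, f, e⟩ <;> rw [e] at hi ⊢
        · exact hbot _
        · obtain ⟨M', N', h1', h2⟩ := hi
          cases h1.unique h1'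
          exact h2.1
      · change R (arg2 (c i)) N
        have hi := h i
        rcases hle i with e | ⟨x, y, f, e⟩ <;> rw [e] at hi ⊢
        · exact hbot _
        · obtain ⟨M', N', h1', h2⟩ := hi
          cases h1.unique h1'
          exact h2.2
    · obtain ⟨M, h1, -⟩ := hP
      -- Suprema of functions are pointwise, so closure of `R` under suprema is used at each
      -- argument `y`.
      refine ⟨M, h1, fun y Q hQ => hsup _ _ fun i => ?_⟩
      change R (fnPart (c i) y) _
      have hi := h i
      rcases hle i with e | ⟨x, z, f, e⟩ <;> rw [e] at hi ⊢
      · exact hbot _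
      · obtain ⟨M', h1', h2⟩ := hi
        cases h1.unique h1'
        exact h2 y Q hQ
  · push Not at hc
    rw [sup_bot c hc]
    trivial

end

end Layer

/-- The logical relation at the `n`-th approximation. -/
def Apx.Rel : (n : ℕ) → Apx n → Prog 0 → Prop
  | 0, _, _ => True
  | n + 1, x, M => Layer.Lifted (Apx.Rel n) (unpack x) M

theorem Apx.Rel.bot : ∀ (n : ℕ) (M : Prog 0), Apx.Rel n ⊥ M
  | 0, _ => trivial
  | _ + 1, _ => trivial

theorem Apx.Rel.sup : ∀ (n : ℕ) (c : Chain (Apx n)) (M : Prog 0), (∀ i, Apx.Rel n (c i) M) →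
    Apx.Rel n (ωSup c) M
  | 0, _, _, _ => trivial
  | n + 1, c, _, h => Layer.Lifted.sup (Apx.Rel.bot n) (Apx.Rel.sup n) c h

/-- The statement covers embeddings and projections at once, because at a function each needs the
other one level down. The two indices change places in that call, hence the measure `n + m`. -/
theorem Apx.Rel.link : ∀ (n m : ℕ) (x : Apx n) (M : Prog 0), Apx.Rel n x M →
    Apx.Rel m (link n m x) M
  | 0, m, x, M, _ => by rw [link_zero]; exact Apx.Rel.bot m M
  | _ + 1, 0, _, _, _ => trivial
  | n + 1, m + 1, x, M, h => by
    rw [link_succ]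
    exact Layer.Lifted.map (Apx.Rel.link n m) (Apx.Rel.link m n) h
termination_by n m => n + m

/-! ### The logical relation on the limit and its fundamental lemma -/

namespace D

open Prog

/-- The logical relation between `D` and closed programs. -/
def Rel (d : D) (M : Prog 0) : Prop := ∀ n, Apx.Rel n (proj n d) M

theorem Rel.bot (M : Prog 0) : Rel ⊥ M := fun n => Apx.Rel.bot n M

theorem Rel.sup (c : Chain D) (M : Prog 0) (h : ∀ i, Rel (c i) M) : Rel (ωSup c) M := fun n => by
  rw [(proj n).continuous]
  exact Apx.Rel.sup n _ M fun i => h i n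

theorem Rel.emb {n : ℕ} {x : Apx n} {M : Prog 0} (h : Apx.Rel n x M) : Rel (D.emb n x) M :=
  fun m => Apx.Rel.link n m x M h

/-- This is the recursive equation one would like to take as a definition of `Rel`, but cannot,
since `Rel` occurs negatively at functions. Forwards, `unroll d` is the supremum of its
approximants, each of which is related; backwards, the equation is projected to every level. -/
theorem rel_iff {d : D} {M : Prog 0} : Rel d M ↔ Layer.Lifted Rel (unroll d) M := by
  constructor
  · intro h
    refine Layer.Lifted.sup Rel.bot Rel.sup _ fun n => ?_
    exact Layer.Lifted.map (R := Apx.Rel n) (fun _ _ => Rel.emb) (fun _ _ h => h n) (h (n + 1))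
  · intro h n
    cases n with
    | zero => trivial
    | succ n =>
      rw [← roll_unroll d, proj_roll]
      exact Layer.Lifted.map (S := Apx.Rel n) (fun _ _ h => h n) (fun _ _ => Rel.emb) h

theorem rel_roll_iff {s : Layer D} {M : Prog 0} : Rel (roll s) M ↔ Layer.Lifted Rel s M := by
  rw [rel_iff, unroll_roll]

theorem Rel.of_steps {d : D} {M N : Prog 0} (h : Rel d N) (hs : Relation.ReflTransGen Step M N) :
    Rel d M :=
  rel_iff.2 ((rel_iff.1 h).of_steps hs)

theorem Rel.of_step {d : D} {M N : Prog 0} (h : Rel d N) (hs : Step M N) : Rel d M :=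
  h.of_steps (.single hs)

theorem Rel.app {a b : D} {M N : Prog 0} (hM : Rel a M) (hN : Rel b N) :
    Rel (D.app a b) (Prog.app M N) := by
  rw [← roll_unroll a, app_roll]
  rw [rel_iff] at hM
  generalize unroll a = s at hM ⊢
  cases s
  case fn f =>
    obtain ⟨L, h1, h2⟩ := hM
    refine (h2 b N hN).of_steps ?_
    exact .tail (h1.1.lift (Prog.app · N) fun _ _ => Step.app N) (Step.beta L N)
  all_goals exact Rel.bot _

theorem Rel.sapp {a b : D} {M N : Prog 0} (hM : Rel a M) (hN : Rel b N) :
    Rel (D.sapp a b) (Prog.sapp M N) := by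
  by_cases hb : b = ⊥
  · rw [D.sapp, if_pos hb]; exact Rel.bot _
  · rw [sapp_of_ne hb, ← roll_unroll a, app_roll]
    obtain ⟨V, hV, hV'⟩ := (rel_iff.1 hN).exists_evals fun e => hb (unroll_eq_bot.1 e)
    rw [rel_iff] at hM
    generalize unroll a = s at hM ⊢
    cases s
    case fn f =>
      obtain ⟨L, h1, h2⟩ := hM
      refine (h2 b V (rel_iff.2 hV')).of_steps ?_
      -- The argument has to be evaluated first: the rule for reducing the function part requires a
      -- weak head normal form on the right.
      refine (hV.1.lift (Prog.sapp M) fun _ _ => Step.sappR M).trans ?_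
      exact .tail (h1.1.lift (Prog.sapp · V) fun _ _ => Step.sappL V hV.2) (Step.sbeta L V hV.2)
    all_goals exact Rel.bot _

theorem Rel.fix {a : D} {M : Prog 0} (hM : Rel a M) : Rel (D.fix a) (Prog.fix M) := by
  rw [D.fix]
  have hM' := rel_iff.1 hM
  cases ha : unroll a
  case fn f =>
    -- The least fixed point is the supremum of the iterates from ⊥. Each iterate is related to the
    -- same program `rec M`, since `rec M` unfolds to `M (rec M)`.
    refine Rel.sup _ _ fun i => ?_
    change Rel (f^[i] ⊥) _
    induction i with
    | zero => exact Rel.bot _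
    | succ i ih =>
      rw [Function.iterate_succ_apply']
      have := (hM.app ih).of_step (Step.fix M)
      rwa [← roll_unroll a, app_roll, ha] at this
  all_goals exact Rel.bot _

theorem Rel.caseLR {a : D} {l r : D → D} {M : Prog 0} {L R : Prog 1} (hM : Rel a M)
    (hl : ∀ d N, Rel d N → Rel (l d) (inst L N)) (hr : ∀ d N, Rel d N → Rel (r d) (inst R N)) :
    Rel (D.caseLR a l r) (Prog.caseLR M L R) := by
  rw [D.caseLR]
  rw [rel_iff] at hM
  generalize unroll a = s at hM ⊢
  cases s
  case left d =>
    obtain ⟨N, h1, h2⟩ := hM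
    exact (hl d N h2).of_steps (.tail
      (h1.1.lift (Prog.caseLR · L R) fun _ _ => Step.caseLRArg L R) (Step.caseLeft N L R))
  case right d =>
    obtain ⟨N, h1, h2⟩ := hM
    exact (hr d N h2).of_steps (.tail
      (h1.1.lift (Prog.caseLR · L R) fun _ _ => Step.caseLRArg L R) (Step.caseRight N L R))
  all_goals exact Rel.bot _

theorem Rel.casePair {a : D} {g : D → D → D} {M : Prog 0} {N : Prog 2} (hM : Rel a M)
    (hg : ∀ d e P Q, Rel d P → Rel e Q → Rel (g d e) (inst₂ N P Q)) :
    Rel (D.casePair a g) (Prog.casePair M N) := by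
  rw [D.casePair]
  rw [rel_iff] at hM
  generalize unroll a = s at hM ⊢
  cases s
  case pair d e =>
    obtain ⟨P, Q, h1, h2, h3⟩ := hM
    exact (hg d e P Q h2 h3).of_steps (.tail
      (h1.1.lift (Prog.casePair · N) fun _ _ => Step.casePairArg N) (Step.casePair P Q N))
  all_goals exact Rel.bot _

theorem Rel.caseAmb {a : D} {g : D → D → D} {M : Prog 0} {N : Prog 2} (hM : Rel a M)
    (hg : ∀ d e P Q, Rel d P → Rel e Q → Rel (g d e) (inst₂ N P Q)) :
    Rel (D.caseAmb a g) (Prog.caseAmb M N) := by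
  rw [D.caseAmb]
  rw [rel_iff] at hM
  generalize unroll a = s at hM ⊢
  cases s
  case amb d e =>
    obtain ⟨P, Q, h1, h2, h3⟩ := hM
    exact (hg d e P Q h2 h3).of_steps (.tail
      (h1.1.lift (Prog.caseAmb · N) fun _ _ => Step.caseAmbArg N) (Step.caseAmb P Q N))
  all_goals exact Rel.bot _

theorem Rel.extend {n : ℕ} {η : Fin n → D} {σ : Fin n → Prog 0} (h : ∀ i, Rel (η i) (σ i)) {d : D}
    {P : Prog 0} (hd : Rel d P) (i : Fin (n + 1)) :
    Rel (_root_.extend d η i) (_root_.extend P σ i) :=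
  Fin.cases hd h i

/-- The fundamental lemma of the logical relation. -/
theorem rel_den {n : ℕ} (M : Prog n) (η : Fin n → D) (σ : Fin n → Prog 0)
    (h : ∀ i, Rel (η i) (σ i)) : Rel (den M η) (subst σ M) := by
  induction M with
  | var i => exact h i
  | lam M ih =>
    refine rel_roll_iff.2 ⟨_, .of_whnf (.inr ⟨_, rfl⟩), fun d P hd => ?_⟩
    rw [inst_subst_lift]
    exact ih _ _ (Rel.extend h hd)
  | app M N ihM ihN => exact (ihM _ _ h).app (ihN _ _ h)
  | sapp M N ihM ihN => exact (ihM _ _ h).sapp (ihN _ _ h)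
  | fix M ih => exact (ih _ _ h).fix
  | bot => exact Rel.bot _
  | nil => exact rel_roll_iff.2 (.of_whnf (.inl .nil))
  | left M ih => exact rel_roll_iff.2 ⟨_, .of_whnf (.inl (.left _)), ih _ _ h⟩
  | right M ih => exact rel_roll_iff.2 ⟨_, .of_whnf (.inl (.right _)), ih _ _ h⟩
  | pair M N ihM ihN =>
    exact rel_roll_iff.2 ⟨_, _, .of_whnf (.inl (.pair _ _)), ihM _ _ h, ihN _ _ h⟩
  | amb M N ihM ihN =>
    exact rel_roll_iff.2 ⟨_, _, .of_whnf (.inl (.amb _ _)), ihM _ _ h, ihN _ _ h⟩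
  | caseLR M L R ihM ihL ihR =>
    refine (ihM _ _ h).caseLR (fun d N hd => ?_) (fun d N hd => ?_) <;> rw [inst_subst_lift]
    · exact ihL _ _ (Rel.extend h hd)
    · exact ihR _ _ (Rel.extend h hd)
  | casePair M N ihM ihN =>
    refine (ihM _ _ h).casePair fun d e P Q hd he => ?_
    rw [inst₂_subst_lift]
    exact ihN _ _ (Rel.extend (Rel.extend h hd) he)
  | caseAmb M N ihM ihN =>
    refine (ihM _ _ h).caseAmb fun d e P Q hd he => ?_
    rw [inst₂_subst_lift]
    exact ihN _ _ (Rel.extend (Rel.extend h hd) he)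

theorem rel_val (P : Prog 0) : Rel (val P) P := by
  have := rel_den P Fin.elim0 var fun i => i.elim0
  rwa [subst_var] at this

end D

/-! ### Adequacy for termination -/

namespace Prog

/-- Adequacy: a closed program that does not denote `⊥` evaluates to a weak head normal form. -/
theorem exists_evals {P : Prog 0} (h : val P ≠ ⊥) : ∃ V, Evals P V :=
  ((D.rel_iff.1 (D.rel_val P)).exists_evals fun e => h (D.unroll_eq_bot.1 e)).imp fun _ h => h.1

theorem acc_of_val_ne_bot {P : Prog 0} (h : val P ≠ ⊥) : Acc (flip Step) P :=
  (exists_evals h).elim fun _ => Evals.acc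

end Prog

/-! ## Infinite reduction sequences -/

/-- Well-founded induction on the starting point: up to the first genuine descent the sequence is
constant, and after it the induction hypothesis applies to the shifted sequence. -/
theorem Acc.eventually_not_rel {α : Type*} {r : α → α → Prop} {x : α} (hx : Acc r x) (A : ℕ → α)
    (h0 : A 0 = x) (h : ∀ i, r (A (i + 1)) (A i) ∨ A (i + 1) = A i) :
    ∃ n, ∀ i ≥ n, ¬ r (A (i + 1)) (A i) := by
  classical
  induction hx generalizing A with
  | intro x _ ih =>
    by_cases he : ∃ i, r (A (i + 1)) (A i)
    · have hc : ∀ j ≤ Nat.find he, A j = x := fun j => by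
        induction j with
        | zero => exact fun _ => h0
        | succ j ihj =>
          exact fun hj => ((h j).resolve_left (Nat.find_min he hj)).trans (ihj (by omega))
      have hr := Nat.find_spec he
      rw [hc _ le_rfl] at hr
      obtain ⟨n, hn⟩ := ih _ hr (fun i => A (i + (Nat.find he + 1)))
        (by simp only [Nat.zero_add]) (fun i => by
          have := h (i + (Nat.find he + 1))
          rwa [show i + (Nat.find he + 1) + 1 = i + 1 + (Nat.find he + 1) by omega] at this)
      refine ⟨n + (Nat.find he + 1), fun i hi => ?_⟩
      obtain ⟨k, rfl⟩ := Nat.exists_eq_add_of_le' (show Nat.find he + 1 ≤ i by omega)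
      have := hn k (by omega)
      rwa [show k + 1 + (Nat.find he + 1) = k + (Nat.find he + 1) + 1 by omega] at this
    · exact ⟨0, fun i _ hi => he ⟨i, hi⟩⟩

theorem Monotone.isLUB_range_shift {α : Type*} [Preorder α] {f : ℕ → α} (hf : Monotone f) {d : α}
    (h : IsLUB (Set.range f) d) (n : ℕ) : IsLUB (Set.range fun i => f (i + n)) d := by
  refine ⟨?_, fun b hb => h.2 ?_⟩
  · rintro _ ⟨i, rfl⟩
    exact h.1 ⟨_, rfl⟩
  · rintro _ ⟨i, rfl⟩
    exact (hf (Nat.le_add_right i n)).trans (hb ⟨i, rfl⟩)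

theorem IsLUB.eq_of_forall_eq {α : Type*} [PartialOrder α] {f : ℕ → α} {c d : α}
    (h : IsLUB (Set.range f) d) (hf : ∀ i, f i = c) : d = c := by
  rw [funext hf, Set.range_const] at h
  exact h.unique isLUB_singleton

theorem IsLUB.eq_map_ωSup {α β : Type*} [OmegaCompletePartialOrder α]
    [OmegaCompletePartialOrder β] {g : α → β} (hg : ωScottContinuous g) (c : Chain α) {d : β}
    (h : IsLUB (Set.range fun i => g (c i)) d) : d = g (ωSup c) := by
  rw [hg.map_ωSup]
  exact h.unique (isLUB_range_ωSup (c.map ⟨g, hg.monotone⟩))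

namespace Prog

/-! ### Single parallel steps: evaluated parts and shapes -/

theorem Step.toD_eq_bot {M M' : Prog 0} (h : Step M M') : toD M = ⊥ := by
  cases M <;> first | rfl | skip
  · exact absurd h not_step_lam
  · exact absurd h IsCon.nil.not_step
  · exact absurd h (IsCon.left _).not_step
  · exact absurd h (IsCon.right _).not_step
  · exact absurd h (IsCon.pair _ _).not_step

theorem CStep.toD_eq_bot {M M' : Prog 0} (h : CStep M M') : toD M = ⊥ := by
  cases h with
  | step h => exact h.toD_eq_bot
  | _ => rfl

theorem CStep.step_or_amb {M M' : Prog 0} (h : CStep M M') : Step M M' ∨ ∃ L R, M = amb L R := by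
  cases h with
  | step h => exact .inl h
  | _ => exact .inr ⟨_, _, rfl⟩

theorem PStep.toD_le {M M' : Prog 0} (h : PStep M M') : toD M ≤ toD M' := by
  induction h with
  | choice h => rw [h.toD_eq_bot]; exact bot_le
  | nil => exact le_rfl
  | left _ ih => exact D.cont_roll.monotone (.left ih)
  | right _ ih => exact D.cont_roll.monotone (.right ih)
  | pair _ _ ih ih' => exact D.cont_roll.monotone (.pair ih ih')
  | lam M => exact le_rfl

/-- Every parallel step other than a plain reduction starts from a weak head normal form: an `Amb`,
a data constructor or an abstraction. -/
theorem PStep.step_of_not_whnf {M M' : Prog 0} (h : PStep M M') (hM : ¬ Whnf M) : Step M M' := by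
  cases h with
  | choice h =>
    rcases h.step_or_amb with h | ⟨L, R, rfl⟩
    · exact h
    · exact absurd (.inl (.amb L R)) hM
  | nil => exact absurd (.inl .nil) hM
  | left => exact absurd (.inl (.left _)) hM
  | right => exact absurd (.inl (.right _)) hM
  | pair => exact absurd (.inl (.pair _ _)) hM
  | lam M => exact absurd (.inr ⟨M, rfl⟩) hM

theorem CStep.eq_amb_of_whnf {M M' : Prog 0} (h : CStep M M') (hM : Whnf M) : ∃ L R, M = amb L R :=
  h.step_or_amb.resolve_left hM.not_step

theorem PStep.of_nil {M : Prog 0} (h : PStep Prog.nil M) : M = Prog.nil := by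
  cases h with
  | choice h => obtain ⟨L, R, h⟩ := h.eq_amb_of_whnf (.inl .nil); cases h
  | nil => rfl

theorem PStep.of_lam {N : Prog 1} {M : Prog 0} (h : PStep (Prog.lam N) M) : M = Prog.lam N := by
  cases h with
  | choice h => obtain ⟨L, R, h⟩ := h.eq_amb_of_whnf (.inr ⟨_, rfl⟩); cases h
  | lam => rfl

theorem PStep.of_left {N M : Prog 0} (h : PStep (Prog.left N) M) :
    ∃ N', M = Prog.left N' ∧ PStep N N' := by
  cases h with
  | choice h => obtain ⟨L, R, h⟩ := h.eq_amb_of_whnf (.inl (.left _)); cases h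
  | left h => exact ⟨_, rfl, h⟩

theorem PStep.of_right {N M : Prog 0} (h : PStep (Prog.right N) M) :
    ∃ N', M = Prog.right N' ∧ PStep N N' := by
  cases h with
  | choice h => obtain ⟨L, R, h⟩ := h.eq_amb_of_whnf (.inl (.right _)); cases h
  | right h => exact ⟨_, rfl, h⟩

theorem PStep.of_pair {N K M : Prog 0} (h : PStep (Prog.pair N K) M) :
    ∃ N' K', M = Prog.pair N' K' ∧ PStep N N' ∧ PStep K K' := by
  cases h with
  | choice h => obtain ⟨L, R, h⟩ := h.eq_amb_of_whnf (.inl (.pair _ _)); cases h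
  | pair h k => exact ⟨_, _, rfl, h, k⟩

theorem PStep.of_amb {L R M : Prog 0} (h : PStep (amb L R) M) :
    (∃ L', M = amb L' R ∧ Step L L') ∨ (∃ R', M = amb L R' ∧ Step R R') ∨
      (M = L ∧ Whnf L) ∨ (M = R ∧ Whnf R) := by
  cases h with
  | choice h =>
    cases h with
    | step h => exact absurd h (IsCon.amb _ _).not_step
    | ambL _ h => exact .inl ⟨_, rfl, h⟩
    | ambR _ h => exact .inr (.inl ⟨_, rfl, h⟩)
    | chooseL _ _ h => exact .inr (.inr (.inl ⟨rfl, h⟩))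
    | chooseR _ _ h => exact .inr (.inr (.inr ⟨rfl, h⟩))

theorem Unfair.of_shift {M : ℕ → Prog 0} (n : ℕ) (h : Unfair fun i => M (i + n)) : Unfair M := by
  induction n with
  | zero => exact h
  | succ n ih =>
    refine ih (.tail _ ?_)
    simp only [Nat.add_right_comm _ 1 n]
    exact h

/-! ### Tails and suprema of computations -/

namespace IsComputation

variable {P : Prog 0} {M : ℕ → Prog 0}

theorem shift (h : IsComputation P M) (n : ℕ) : IsComputation (M n) fun i => M (i + n) where
  start := by simp only [Nat.zero_add]
  step i := by simpa only [Nat.add_right_comm i 1 n] using h.step (i + n)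
  fair hu := h.fair (hu.of_shift n)

theorem monotone_toD (h : IsComputation P M) : Monotone fun i => toD (M i) :=
  monotone_nat_of_le_succ fun i => (h.step i).toD_le

/-- The chain of the fully evaluated parts. -/
noncomputable def chain (h : IsComputation P M) : Chain D := ⟨⟨fun i => toD (M i), h.monotone_toD⟩⟩

theorem isLUB_chain (h : IsComputation P M) :
    IsLUB (Set.range fun i => toD (M i)) (ωSup h.chain) :=
  isLUB_range_ωSup h.chain

/-- Otherwise `M 0` would be accessible for reversed reduction, which an infinite reduction
contradicts. -/
theorem val_eq_bot_of_diverges (hM : ∀ i, Step (M i) (M (i + 1))) : val (M 0) = ⊥ := by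
  by_contra h
  obtain ⟨n, hn⟩ := (acc_of_val_ne_bot h).eventually_not_rel M rfl fun i => .inl (hM i)
  exact hn n le_rfl (hM n)

end IsComputation

/-- If in a pair of sequences exactly one side is reduced at each step, and the first side does not
denote `⊥`, then eventually only the second side is reduced. -/
theorem eventually_step_right {A B : ℕ → Prog 0} (hA : val (A 0) ≠ ⊥)
    (h : ∀ i, (Step (A i) (A (i + 1)) ∧ B (i + 1) = B i) ∨
      (A (i + 1) = A i ∧ Step (B i) (B (i + 1)))) :
    ∃ n, ∀ i, A (i + n) = A n ∧ Step (B (i + n)) (B (i + 1 + n)) := by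
  obtain ⟨n, hn⟩ := (acc_of_val_ne_bot hA).eventually_not_rel A rfl
    fun i => (h i).imp And.left And.left
  have h' : ∀ i ≥ n, A (i + 1) = A i ∧ Step (B i) (B (i + 1)) := fun i hi =>
    (h i).resolve_left fun hs => hn i hi hs.1
  refine ⟨n, fun i => ⟨?_, ?_⟩⟩
  · induction i with
    | zero => rw [Nat.zero_add]
    | succ i ih => rw [Nat.add_right_comm, (h' (i + n) (by omega)).1, ih]
  · rw [Nat.add_right_comm]
    exact (h' (i + n) (by omega)).2

/-- `a` is the denotation of a closed program with a computation whose result is `d`. -/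
def Computes (a d : D) : Prop :=
  ∃ P M, IsComputation P M ∧ a = val P ∧ IsLUB (Set.range fun i => toD (M i)) d

/-! ### Consistency of `Computes` with the clauses of `data` -/

theorem IsComputation.computes_shift {P : Prog 0} {M : ℕ → Prog 0} (h : IsComputation P M) {d : D}
    (hd : IsLUB (Set.range fun i => toD (M i)) d) (n : ℕ) : Computes (val (M n)) d :=
  ⟨_, _, h.shift n, rfl, h.monotone_toD.isLUB_range_shift hd n⟩

theorem IsComputation.dataClauses_amb {L₀ R₀ : Prog 0} {M : ℕ → Prog 0}
    (h : IsComputation (amb L₀ R₀) M) {d : D} (hd : IsLUB (Set.range fun i => toD (M i)) d) :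
    DataClauses Computes (val (amb L₀ R₀)) d := by
  -- The question is whether a side is ever chosen. Carrying the equalities of denotations allows
  -- the chosen reduct to be replaced by the original side in the clause.
  by_cases hc : ∃ i L R, M i = amb L R ∧ val L = val L₀ ∧ val R = val R₀ ∧
      ((M (i + 1) = L ∧ Whnf L) ∨ (M (i + 1) = R ∧ Whnf R))
  · obtain ⟨i, L, R, -, hL, hR, ⟨hi, hw⟩ | ⟨hi, hw⟩⟩ := hc
    · refine .inl ⟨val L₀, val R₀, rfl, hL ▸ hw.val_ne_bot, ?_⟩
      rw [← hL, ← hi]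
      exact h.computes_shift hd _
    · refine .inr (.inl ⟨val L₀, val R₀, rfl, hR ▸ hw.val_ne_bot, ?_⟩)
      rw [← hR, ← hi]
      exact h.computes_shift hd _
  · have next : ∀ i L R, M i = amb L R → val L = val L₀ → val R = val R₀ →
        ∃ L' R', M (i + 1) = amb L' R' ∧
          ((Step L L' ∧ R' = R) ∨ (L' = L ∧ Step R R')) := by
      intro i L R hi hL hR
      have hs := h.step i
      rw [hi] at hs
      rcases hs.of_amb with ⟨L', e, hs⟩ | ⟨R', e, hs⟩ | hs
      · exact ⟨L', R, e, .inl ⟨hs, rfl⟩⟩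
      · exact ⟨L, R', e, .inr ⟨rfl, hs⟩⟩
      · exact absurd ⟨i, L, R, hi, hL, hR, hs⟩ hc
    have all : ∀ i, ∃ L R, M i = amb L R ∧ val L = val L₀ ∧ val R = val R₀ := by
      intro i
      induction i with
      | zero => exact ⟨L₀, R₀, h.start, rfl, rfl⟩
      | succ i ih =>
        obtain ⟨L, R, hi, hL, hR⟩ := ih
        obtain ⟨L', R', e, ⟨hs, rfl⟩ | ⟨rfl, hs⟩⟩ := next i L R hi hL hR
        · exact ⟨L', R', e, hs.val_eq ▸ hL, hR⟩
        · exact ⟨L', R', e, hL, hs.val_eq ▸ hR⟩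
    choose L R hM hL hR using all
    have hs : ∀ i, (Step (L i) (L (i + 1)) ∧ R (i + 1) = R i) ∨
        (L (i + 1) = L i ∧ Step (R i) (R (i + 1))) := by
      intro i
      obtain ⟨L', R', e, hs⟩ := next i _ _ (hM i) (hL i) (hR i)
      rw [hM (i + 1)] at e
      cases e
      exact hs
    have hL₀ : val L₀ = ⊥ := by
      by_contra hne
      obtain ⟨n, hn⟩ := eventually_step_right (hL 0 ▸ hne) hs
      -- If the left side did not denote ⊥, it would be frozen at `L n` from stage `n` on, while the
      -- right side reduces forever.
      refine h.fair (Unfair.of_shift n (.ambR _ (fun i => R (i + n)) (L n) (fun i => ?_)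
        fun i => (hn i).2))
      rw [hM, (hn i).1]
    have hR₀ : val R₀ = ⊥ := by
      by_contra hne
      obtain ⟨n, hn⟩ := eventually_step_right (hR 0 ▸ hne) fun i =>
        (hs i).symm.imp And.symm And.symm
      refine h.fair (Unfair.of_shift n (.ambL _ (fun i => L (i + n)) (R n) (fun i => ?_)
        fun i => (hn i).2))
      rw [hM, (hn i).1]
    -- An `Amb` has evaluated part ⊥ at every stage, so the supremum is ⊥, as the clause for
    -- Amb(⊥,⊥) demands.
    refine .inr (.inr (.inl ⟨?_, hd.eq_of_forall_eq fun i => by rw [hM i]; rfl⟩))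
    exact congrArg₂ D.amb hL₀ hR₀

theorem IsComputation.dataClauses_of_whnf {P : Prog 0} {M : ℕ → Prog 0} (h : IsComputation P M)
    (hP : Whnf P) {d : D} (hd : IsLUB (Set.range fun i => toD (M i)) d) :
    DataClauses Computes (val P) d := by
  rcases hP with hP | ⟨N, rfl⟩
  · cases hP with
    | nil =>
      have hM : ∀ i, M i = nil := fun i => by
        induction i with
        | zero => exact h.start
        | succ i ih => exact (ih ▸ h.step i).of_nil
      exact .inr (.inr (.inr (.inl ⟨rfl, hd.eq_of_forall_eq fun i => by rw [hM i]; rfl⟩)))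
    | left P =>
      have hM : ∀ i, ∃ N, M i = left N := fun i => by
        induction i with
        | zero => exact ⟨P, h.start⟩
        | succ i ih =>
          obtain ⟨N, hN⟩ := ih
          exact (hN ▸ h.step i).of_left.imp fun _ => And.left
      choose N hN using hM
      -- The components inherit fairness, since an unfair sequence below a data constructor makes
      -- the whole sequence unfair.
      have hc : IsComputation P N := by
        refine ⟨?_, fun i => ?_, fun hu => h.fair (.left M N hN hu)⟩
        · have := h.start; rw [hN 0] at this; cases this; rfl
        · have := h.step i
          rw [hN i, hN (i + 1)] at this
          obtain ⟨_, e, hs⟩ := this.of_left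
          cases e; exact hs
      refine .inr (.inr (.inr (.inr (.inl ⟨val P, ωSup hc.chain, rfl, ?_, P, N, hc, rfl,
        hc.isLUB_chain⟩))))
      simp only [hN] at hd
      exact IsLUB.eq_map_ωSup (D.cont_left ωScottContinuous.fun_id) hc.chain hd
    | right P =>
      have hM : ∀ i, ∃ N, M i = right N := fun i => by
        induction i with
        | zero => exact ⟨P, h.start⟩
        | succ i ih =>
          obtain ⟨N, hN⟩ := ih
          exact (hN ▸ h.step i).of_right.imp fun _ => And.left
      choose N hN using hM
      have hc : IsComputation P N := by
        refine ⟨?_, fun i => ?_, fun hu => h.fair (.right M N hN hu)⟩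
        · have := h.start; rw [hN 0] at this; cases this; rfl
        · have := h.step i
          rw [hN i, hN (i + 1)] at this
          obtain ⟨_, e, hs⟩ := this.of_right
          cases e; exact hs
      refine .inr (.inr (.inr (.inr (.inr (.inl ⟨val P, ωSup hc.chain, rfl, ?_, P, N, hc, rfl,
        hc.isLUB_chain⟩)))))
      simp only [hN] at hd
      exact IsLUB.eq_map_ωSup (D.cont_right ωScottContinuous.fun_id) hc.chain hd
    | pair P Q =>
      have hM : ∀ i, ∃ N K, M i = pair N K := fun i => by
        induction i with
        | zero => exact ⟨P, Q, h.start⟩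
        | succ i ih =>
          obtain ⟨N, K, hN⟩ := ih
          exact (hN ▸ h.step i).of_pair.imp fun _ => Exists.imp fun _ => And.left
      choose N K hN using hM
      have hs : ∀ i, PStep (N i) (N (i + 1)) ∧ PStep (K i) (K (i + 1)) := fun i => by
        have := h.step i
        rw [hN i, hN (i + 1)] at this
        obtain ⟨_, _, e, hs⟩ := this.of_pair
        cases e; exact hs
      have h0 := h.start
      rw [hN 0] at h0
      injection h0 with _ hP hQ
      have hc : IsComputation P N :=
        ⟨hP, fun i => (hs i).1, fun hu => h.fair (.pairL M N K hN hu)⟩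
      have hc' : IsComputation Q K :=
        ⟨hQ, fun i => (hs i).2, fun hu => h.fair (.pairR M N K hN hu)⟩
      refine .inr (.inr (.inr (.inr (.inr (.inr (.inl ⟨val P, val Q, ωSup hc.chain, ωSup hc'.chain,
        rfl, ?_, ⟨P, N, hc, rfl, hc.isLUB_chain⟩, ⟨Q, K, hc', rfl, hc'.isLUB_chain⟩⟩))))))
      simp only [hN] at hd
      -- Pairing is treated as one continuous map on `D × D`, applied to the zipped chain of both
      -- components.
      exact IsLUB.eq_map_ωSup (D.cont_pair Prod.ωScottContinuous_fst Prod.ωScottContinuous_snd)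
        (hc.chain.zip hc'.chain) hd
    | amb L R => exact h.dataClauses_amb hd
  · have hM : ∀ i, M i = lam N := fun i => by
      induction i with
      | zero => exact h.start
      | succ i ih => exact (ih ▸ h.step i).of_lam
    exact .inr (.inr (.inr (.inr (.inr (.inr (.inr (.inl
      ⟨_, rfl, hd.eq_of_forall_eq fun i => by rw [hM i]; rfl⟩)))))))

theorem computes_le_dataClauses : Computes ≤ DataClauses Computes := by
  classical
  rintro _ d ⟨P, M, h, rfl, hd⟩
  by_cases hw : ∃ i, Whnf (M i)
  -- Before the first weak head normal form only plain reductions occur, so the denotation is still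
  -- that of `P` when it is reached; dropping the initial segment does not change the supremum.
  · have hv : ∀ i ≤ Nat.find hw, val (M i) = val P := fun i => by
      induction i with
      | zero => exact fun _ => congrArg val h.start
      | succ i ih =>
        exact fun hi => ((h.step i).step_of_not_whnf (Nat.find_min hw hi)).val_eq.symm.trans
          (ih (by omega))
    rw [← hv _ le_rfl]
    exact (h.shift _).dataClauses_of_whnf (Nat.find_spec hw) (h.monotone_toD.isLUB_range_shift hd _)
  · have hs : ∀ i, Step (M i) (M (i + 1)) := fun i =>
      (h.step i).step_of_not_whnf fun hi => hw ⟨i, hi⟩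
    refine .inr (.inr (.inr (.inr (.inr (.inr (.inr (.inr ⟨?_, ?_⟩)))))))
    · rw [← h.start]; exact IsComputation.val_eq_bot_of_diverges hs
    · exact hd.eq_of_forall_eq fun i => (hs i).toD_eq_bot

end Prog

theorem theorem3p1 (P : Prog 0) (M : ℕ → Prog 0) (hM : Prog.IsComputation P M) :
    Monotone (fun i => Prog.toD (M i)) ∧
      ∃ d : D, IsLUB (Set.range fun i => Prog.toD (M i)) d ∧ d ∈ data (val P) :=
  -- Coinduction: a relation contained in its own image under the clauses is contained in the
  -- greatest fixed point.
  ⟨hM.monotone_toD, _, hM.isLUB_chain, OrderHom.le_gfp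
    (⟨DataClauses, DataClauses.mono⟩ : (D → D → Prop) →o (D → D → Prop))
    Prog.computes_le_dataClauses _ _ ⟨P, M, hM, rfl, hM.isLUB_chain⟩⟩
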